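/- **Conventions.** A deterministic, nondeterministic or probabilistic $k$-OBDD on $n$ Boolean variables is a leveled program with $kn$ steps, divided into $k$ layers of $n$ steps; in every layer it tests each variable exactly once, all layers use the same order $\pi$ of the variables, and all nodes of one level test the same variable. A node of a deterministic program has exactly one outgoing edge for each value of the tested bit, a node of a nondeterministic program has any number of them (an input is accepted if some consistent path from the source ends in an accepting sink), and a node of a probabilistic program has, for each value of the tested bit, a probability distribution on the next level. The width is the largest number of nodes on a level other than the level of the sinks. A quantum $k$-OBDD of width $w$ starts in a basis vector of $\mathbb C^w$, applies at each step one of two unitary matrices selected by the tested bit, and after the last step is measured in the standard basis and accepts if the outcome is in a given set. For $0<\varepsilon\le\frac12$ a probabilistic or quantum program computes $f$ with error $\frac12-\varepsilon$ if it accepts with probability at least $\frac12+\varepsilon$ where $f=1$ and at most $\frac12-\varepsilon$ where $f=0$. For real $w$, $k$-**OBDD**$_w$ is the set of Boolean functions computed by a deterministic $k$-OBDD of width at most $w$ with some order; $k$-id-**OBDD**$_w$, $k$-id-**NOBDD**$_w$, $k$-id-**POBDD**$_w^\varepsilon$, $k$-id-**QOBDD**$_w^\varepsilon$ are the corresponding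 classes for programs (deterministic, nondeterministic, probabilistic or quantum with error $\frac12-\varepsilon$) that read the variables in the natural order. Logarithms are to base 2. For $d=2^t$ and $n\ge 2kdt$, the function $MXPJ_{2k,d}:\{0,1\}^n\to\{0,1\}$ reads its first $2kdt$ variables as the value tables (blocks of $t$ bits) of maps $f_{A,1},\dots,f_{A,k},f_{B,1},\dots,f_{B,k}$ from $\{0,\dots,d-1\}$ to itself, in this order. Let $f_{2i-1}=f_{A,i}$, $f_{2i}=f_{B,i}$, $v_{-1}=v_0=0$ and $v_{j+1}=f_{j+1}(v_j)\oplus v_{j-1}$ for $j\ge 0$, with $\oplus$ the bitwise exclusive or. The value of $MXPJ_{2k,d}$ is the parity of the binary representation of $v_{2k}$. **Theorem.** There are an absolute constant $C_1>0$ and a threshold $D(\varepsilon)$ that depends only on $\varepsilon$ such that the following holds. (1) For all integers $k\ge 2$, $d\ge 2$ and all sufficiently large $n$ (in terms of $k,d$) there is a Boolean function $f$ of $n$ variables such that * $f\in k\text{-id-}\mathbf{OBDD}_{d^2}$, $f\in k\text{-id-}\mathbf{NOBDD}_{d^2}$, and $f\in k\text{-id-}\mathbf{POBDD}^{\varepsilon}_{d^2}$,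 $f\in k\text{-id-}\mathbf{QOBDD}^{\varepsilon}_{d^2}$ for every $\varepsilon\in(0,\frac12]$; * $f\notin k\text{-}\mathbf{OBDD}_{\lfloor d/32\rfloor-3}$, for any order of the variables, and $f\notin k\text{-id-}\mathbf{NOBDD}_{\sqrt{d\log d/33}}$; * $f\notin k\text{-id-}\mathbf{POBDD}^{\varepsilon}_{\sqrt{d/\log k}}$ and $f\notin k\text{-id-}\mathbf{QOBDD}^{\varepsilon}_{\sqrt{d/(C_1k)}}$ for every $\varepsilon\in(0,\frac12]$ with $d\ge D(\varepsilon)$. (2) For all integers $k\ge2$, all powers of two $d=2^t\ge 2$ and all $n\ge 2kdt$, the function $f=MXPJ_{2k,d}$ of $n$ variables has all these properties, with $k\text{-}\mathbf{OBDD}_{\lfloor d/32\rfloor-3}$ replaced by its natural-order version $k\text{-id-}\mathbf{OBDD}_{\lfloor d/32\rfloor-3}$. -/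

import Mathlib

open Finset

/-! ### Layered ordered programs

A program with `k` layers on `n` Boolean variables performs the steps `0, …, k * n - 1`.
Layer `i` consists of the steps `i * n, …, i * n + n - 1`, and all layers read the variables in the
same order.  The nodes at level `j` are the elements of `Fin (size j)`; level `k * n` consists of
the sinks, which do not count for the width. -/

/-- The bit of `x` which is tested at step `j` by a layered program with variable order `π`. -/
def readBit {n : ℕ} (π : Equiv.Perm (Fin n)) (x : Fin n → Bool) (j : ℕ) : Bool :=
  if h : 0 < n then x (π ⟨j % n, Nat.mod_lt j h⟩) else false

/-- Deterministic `k`-OBDD on `n` variables. -/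
structure DetOBDD (k n : ℕ) where
  /-- the common variable order of all layers -/
  order : Equiv.Perm (Fin n)
  /-- the number of nodes of each level -/
  size : ℕ → ℕ
  /-- the source node -/
  source : Fin (size 0)
  /-- the edge labelled `b` that leaves a node of level `j` -/
  next : (j : ℕ) → (b : Bool) → Fin (size j) → Fin (size (j + 1))
  /-- the accepting sinks -/
  accept : Finset (Fin (size (k * n)))

namespace DetOBDD

variable {k n : ℕ}

/-- The largest number of nodes on a level of inner nodes. -/
def width (P : DetOBDD k n) : ℕ := (range (k * n)).sup P.size

/-- The node reached on input `x` before step `j`. -/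
def run (P : DetOBDD k n) (x : Fin n → Bool) : (j : ℕ) → Fin (P.size j)
  | 0 => P.source
  | j + 1 => P.next j (readBit P.order x j) (P.run x j)

def Computes (P : DetOBDD k n) (f : (Fin n → Bool) → Bool) : Prop :=
  ∀ x, f x = true ↔ P.run x (k * n) ∈ P.accept

end DetOBDD

/-- Nondeterministic `k`-OBDD on `n` variables: any number of edges with label `b` may leave a
node. -/
structure NondetOBDD (k n : ℕ) where
  order : Equiv.Perm (Fin n)
  size : ℕ → ℕ
  source : Fin (size 0)
  /-- `edge j b u v`: there is an edge labelled `b` from node `u` of level `j` to node `v` of the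
  next level -/
  edge : (j : ℕ) → (b : Bool) → Fin (size j) → Fin (size (j + 1)) → Prop
  accept : Finset (Fin (size (k * n)))

namespace NondetOBDD

variable {k n : ℕ}

def width (P : NondetOBDD k n) : ℕ := (range (k * n)).sup P.size

/-- The nodes of level `j` that are ends of a path from the source consistent with `x`. -/
def reach (P : NondetOBDD k n) (x : Fin n → Bool) : (j : ℕ) → Set (Fin (P.size j))
  | 0 => {P.source}
  | j + 1 => {v | ∃ u ∈ P.reach x j, P.edge j (readBit P.order x j) u v}

def Computes (P : NondetOBDD k n) (f : (Fin n → Bool) → Bool) : Prop :=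
  ∀ x, f x = true ↔ ∃ v ∈ P.accept, v ∈ P.reach x (k * n)

end NondetOBDD

/-- Probabilistic `k`-OBDD on `n` variables. -/
structure ProbOBDD (k n : ℕ) where
  order : Equiv.Perm (Fin n)
  size : ℕ → ℕ
  source : Fin (size 0)
  /-- `trans j b u v`: the probability to move from node `u` of level `j` to node `v` of the next
  level if the tested bit is `b` -/
  trans : (j : ℕ) → (b : Bool) → Matrix (Fin (size j)) (Fin (size (j + 1))) ℝ
  trans_nonneg : ∀ j < k * n, ∀ b u v, 0 ≤ trans j b u v
  trans_sum : ∀ j < k * n, ∀ b u, ∑ v, trans j b u v = 1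
  accept : Finset (Fin (size (k * n)))

namespace ProbOBDD

variable {k n : ℕ}

def width (P : ProbOBDD k n) : ℕ := (range (k * n)).sup P.size

/-- The distribution of the node at level `j` on input `x`. -/
def dist (P : ProbOBDD k n) (x : Fin n → Bool) : (j : ℕ) → Fin (P.size j) → ℝ
  | 0 => Pi.single P.source 1
  | j + 1 => Matrix.vecMul (P.dist x j) (P.trans j (readBit P.order x j))

def acceptProb (P : ProbOBDD k n) (x : Fin n → Bool) : ℝ :=
  ∑ v ∈ P.accept, P.dist x (k * n) v

end ProbOBDD

/-- Quantum `k`-OBDD of width `w` on `n` variables, measured after the last step. -/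
structure QuantumOBDD (k n w : ℕ) where
  order : Equiv.Perm (Fin n)
  source : Fin w
  /-- the unitary matrix applied at step `j` if the tested bit is `b` -/
  gate : (j : ℕ) → (b : Bool) → Matrix.unitaryGroup (Fin w) ℂ
  accept : Finset (Fin w)

namespace QuantumOBDD

variable {k n w : ℕ}

/-- The state vector on input `x` before step `j`. -/
def state (P : QuantumOBDD k n w) (x : Fin n → Bool) : ℕ → Fin w → ℂ
  | 0 => Pi.single P.source 1
  | j + 1 =>
    Matrix.mulVec (P.gate j (readBit P.order x j) : Matrix (Fin w) (Fin w) ℂ) (P.state x j)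

noncomputable def acceptProb (P : QuantumOBDD k n w) (x : Fin n → Bool) : ℝ :=
  ∑ i ∈ P.accept, ‖P.state x (k * n) i‖ ^ 2

end QuantumOBDD

/-- Acceptance probability `p` computes `f` with error at most `1 / 2 - ε`. -/
def ComputesWithMargin {n : ℕ} (ε : ℝ) (p : (Fin n → Bool) → ℝ) (f : (Fin n → Bool) → Bool) :
    Prop :=
  ∀ x, (f x = true → 1 / 2 + ε ≤ p x) ∧ (f x = false → p x ≤ 1 / 2 - ε)

/-! ### Complexity classes of functions of `n` bits

The width bound `w` is a real number: a program belongs to the class if its width is at most `w`. -/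

/-- `k`-OBDD of width at most `w`, with an arbitrary order of the variables. -/
def classOBDD (k n : ℕ) (w : ℝ) : Set ((Fin n → Bool) → Bool) :=
  {f | ∃ P : DetOBDD k n, (P.width : ℝ) ≤ w ∧ P.Computes f}

/-- `k`-OBDD of width at most `w` with the natural order. -/
def classIdOBDD (k n : ℕ) (w : ℝ) : Set ((Fin n → Bool) → Bool) :=
  {f | ∃ P : DetOBDD k n, P.order = 1 ∧ (P.width : ℝ) ≤ w ∧ P.Computes f}

/-- Nondeterministic `k`-OBDD of width at most `w` with the natural order. -/
def classIdNOBDD (k n : ℕ) (w : ℝ) : Set ((Fin n → Bool) → Bool) :=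
  {f | ∃ P : NondetOBDD k n, P.order = 1 ∧ (P.width : ℝ) ≤ w ∧ P.Computes f}

/-- Probabilistic `k`-OBDD of width at most `w` with the natural order and error at most
`1 / 2 - ε`. -/
def classIdPOBDD (k n : ℕ) (ε w : ℝ) : Set ((Fin n → Bool) → Bool) :=
  {f | ∃ P : ProbOBDD k n, P.order = 1 ∧ (P.width : ℝ) ≤ w ∧
    ComputesWithMargin ε P.acceptProb f}

/-- Quantum `k`-OBDD of width at most `w` with the natural order and error at most `1 / 2 - ε`. -/
def classIdQOBDD (k n : ℕ) (ε w : ℝ) : Set ((Fin n → Bool) → Bool) :=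
  {f | ∃ (m : ℕ) (P : QuantumOBDD k n m), P.order = 1 ∧ (m : ℝ) ≤ w ∧
    ComputesWithMargin ε P.acceptProb f}

/-! ### Matrix XOR pointer jumping

Here `d = 2 ^ t`; the vertices are `0, …, 2 ^ t - 1`, and `^^^` is the bitwise exclusive or.
The input consists of blocks of `t` bits, followed by variables that are ignored.  The blocks are
`a_{1,0}, …, a_{1,d-1}, …, a_{k,0}, …, a_{k,d-1}, b_{1,0}, …, b_{k,d-1}`. -/

/-- The number written in block `p` of the input, a number below `2 ^ t`. -/
def blockVal (t : ℕ) {n : ℕ} (x : Fin n → Bool) (p : ℕ) : ℕ :=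
  Nat.ofBits fun b : Fin t => if h : p * t + b < n then x ⟨p * t + b, h⟩ else false

/-- The value at the vertex `v` of the function `f_{s+1}`, which is `f_{A,s/2+1}` for even `s` and
`f_{B,(s-1)/2+1}` for odd `s`. -/
def mxpjTable (k t : ℕ) {n : ℕ} (x : Fin n → Bool) (s v : ℕ) : ℕ :=
  blockVal t x ((if Even s then s / 2 else k + s / 2) * 2 ^ t + v)

/-- The `j`-th vertex, starting from `v₀ = 0`:
`v_{j+1} = f_{j+1}(v_j) ⊕ v_{j-1}`, with `v_{-1} = 0`. -/
def mxpjVertex (k t : ℕ) {n : ℕ} (x : Fin n → Bool) : ℕ → ℕ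
  | 0 => 0
  | 1 => mxpjTable k t x 0 0
  | j + 2 => mxpjTable k t x (j + 1) (mxpjVertex k t x (j + 1)) ^^^ mxpjVertex k t x j

/-- The Boolean function `MXPJ_{2k,d}` with `d = 2 ^ t`, as a function of `n ≥ 2 * k * d * t` bits:
the parity of the binary representation of the vertex `v_{2k}`. -/
def mxpj (k t n : ℕ) (x : Fin n → Bool) : Bool :=
  decide (Odd #{b ∈ range t | (mxpjVertex k t x (2 * k)).testBit b})

/-! Lower bounds. Cut every layer after the same number of steps. An input influences the program
only through what its bits before the cut do in each of the `k` layers and what its bits behind the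
cut do there. If two assignments of one side act alike in all layers, exactly or nearly, then no
assignment of the other side can tell them apart. Hence the number of pairwise distinguishable rows
(`RowsSeparated`) is bounded by the number of possible behaviours. The theorems `card_rows_le` count
these: `k`-tuples of maps, of relations, of stochastic matrices and of unitary matrices. In the last
two cases the entries are rounded to a grid (`exists_close_of_card_lt`) so fine that the error
accumulated over all layers stays below the gap `2 * ε`. For the widths of the theorem all these
numbers are below `d ^ ((k - 1) * (d - 1))`, so it suffices to exhibit functions with that many
rows.

Upper bounds. Both functions are computed by permutations of at most `d ^ 2` states. Such a program
is at once deterministic, nondeterministic, probabilistic and unitary (`mem_classes_of_permRun`).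

For matrix XOR pointer jumping the state is the pair `(v_{2l-1}, v_{2l})`. Adding a table value by
exclusive or to one component, under control of the other, is reversible. The `d - 1` entries at
nonzero vertices of `k - 1` tables of the first half can be chosen freely, and suitable tables of
the second half test any single one of them (`mxpj_query`).

For arbitrary orders, `cellFunction` is built from slots, whose control bits decide which
transposition of states the slot's information bit performs, and in which layer. Whatever the order,
there is a cut with enough information bits on either side (`exists_cut`). The control bits then
assign memory contents to one side and queries to the other. There are `(d ^ 2 - 4) / 2` one-bit
cells, written anew in each of `k - 1` layers, which gives enough rows from `d = 5` on. For smaller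
`d` the excluded classes are empty or the threshold on `d` fails. -/

/-! ### Programs given by permutations -/

/-- The state before step `j` of the program that reads the variables in the natural order and
applies at each step a permutation selected by the tested bit. -/
def permRun {n : ℕ} {σ : Type*} (gate : ℕ → Bool → Equiv.Perm σ) (source : σ)
    (x : Fin n → Bool) : ℕ → σ
  | 0 => source
  | j + 1 => gate j (readBit 1 x j) (permRun gate source x j)

section PermPrograms

variable {k n m : ℕ} (gate : ℕ → Bool → Equiv.Perm (Fin m)) (source : Fin m)
  (acc : Finset (Fin m))

lemma sup_range_const_le (a m : ℕ) : ((range a).sup fun _ => m) ≤ m :=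
  Finset.sup_le fun _ _ => le_rfl

lemma mem_classIdOBDD_of_permRun {f : (Fin n → Bool) → Bool}
    (hf : ∀ x, f x = true ↔ permRun gate source x (k * n) ∈ acc) {W : ℝ} (hW : (m : ℝ) ≤ W) :
    f ∈ classIdOBDD k n W := by
  let P : DetOBDD k n :=
    { order := 1
      size := fun _ => m
      source := source
      next := fun j b => gate j b
      accept := acc }
  have hrun : ∀ x j, P.run x j = permRun gate source x j := by
    intro x j
    induction j with
    | zero => rfl
    | succ j ih => exact congrArg (gate j (readBit 1 x j)) ih
  refine ⟨P, rfl, le_trans ?_ hW, fun x => ?_⟩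
  · exact_mod_cast sup_range_const_le _ _
  · rw [hf x, hrun]

lemma mem_classIdNOBDD_of_permRun {f : (Fin n → Bool) → Bool}
    (hf : ∀ x, f x = true ↔ permRun gate source x (k * n) ∈ acc) {W : ℝ} (hW : (m : ℝ) ≤ W) :
    f ∈ classIdNOBDD k n W := by
  let P : NondetOBDD k n :=
    { order := 1
      size := fun _ => m
      source := source
      edge := fun j b u v => gate j b u = v
      accept := acc }
  have hrun : ∀ x j, P.reach x j = {permRun gate source x j} := by
    intro x j
    induction j with
    | zero => rfl
    | succ j ih =>
      ext v
      change (∃ u ∈ P.reach x j, gate j (readBit 1 x j) u = v) ↔ _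
      rw [ih]
      simp [permRun, eq_comm]
  refine ⟨P, rfl, le_trans ?_ hW, fun x => ?_⟩
  · exact_mod_cast sup_range_const_le _ _
  · rw [hf x, hrun]
    simp only [Set.mem_singleton_iff, exists_eq_right]
    rfl

lemma computesWithMargin_of_indicator {f : (Fin n → Bool) → Bool} {p : (Fin n → Bool) → ℝ}
    (hp : ∀ x, p x = if f x = true then 1 else 0) {ε : ℝ} (hε : ε ≤ 1 / 2) :
    ComputesWithMargin ε p f := by
  intro x
  refine ⟨fun h => ?_, fun h => ?_⟩ <;> rw [hp x, h] <;> norm_num <;> linarith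

lemma mem_classIdPOBDD_of_permRun {f : (Fin n → Bool) → Bool}
    (hf : ∀ x, f x = true ↔ permRun gate source x (k * n) ∈ acc) {W : ℝ} (hW : (m : ℝ) ≤ W)
    {ε : ℝ} (hε : ε ≤ 1 / 2) : f ∈ classIdPOBDD k n ε W := by
  let P : ProbOBDD k n :=
    { order := 1
      size := fun _ => m
      source := source
      trans := fun j b u v => if gate j b u = v then 1 else 0
      trans_nonneg := fun j _ b u v => by split_ifs <;> norm_num
      trans_sum := fun j _ b u => by simp
      accept := acc }
  have hrun : ∀ x j, P.dist x j = Pi.single (permRun gate source x j) 1 := by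
    intro x j
    induction j with
    | zero => rfl
    | succ j ih =>
      change Matrix.vecMul (P.dist x j) _ = _
      rw [ih, Matrix.single_one_vecMul]
      ext v
      change (if gate j (readBit 1 x j) (permRun gate source x j) = v then (1 : ℝ) else 0) = _
      simp [permRun, Pi.single_apply, eq_comm]
  refine ⟨P, rfl, le_trans ?_ hW, computesWithMargin_of_indicator (fun x => ?_) hε⟩
  · exact_mod_cast sup_range_const_le _ _
  · unfold ProbOBDD.acceptProb
    rw [hrun]
    simp only [hf x]
    exact Finset.sum_pi_single' _ _ _

lemma permMatrix_mem_unitaryGroup (e : Equiv.Perm (Fin m)) :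
    e.permMatrix ℂ ∈ Matrix.unitaryGroup (Fin m) ℂ := by
  rw [Matrix.mem_unitaryGroup_iff, Matrix.star_eq_conjTranspose, Matrix.conjTranspose_permMatrix,
    ← Matrix.permMatrix_mul]
  simp

lemma mem_classIdQOBDD_of_permRun {f : (Fin n → Bool) → Bool}
    (hf : ∀ x, f x = true ↔ permRun gate source x (k * n) ∈ acc) {W : ℝ} (hW : (m : ℝ) ≤ W)
    {ε : ℝ} (hε : ε ≤ 1 / 2) : f ∈ classIdQOBDD k n ε W := by
  let P : QuantumOBDD k n m :=
    { order := 1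
      source := source
      -- A permutation matrix acts on vectors by precomposition, so the inverse is what moves the
      -- basis vector at `q` to the one at `gate j b q`.
      gate := fun j b => ⟨(gate j b)⁻¹.permMatrix ℂ, permMatrix_mem_unitaryGroup _⟩
      accept := acc }
  have hrun : ∀ x j, P.state x j = Pi.single (permRun gate source x j) 1 := by
    intro x j
    induction j with
    | zero => rfl
    | succ j ih =>
      change Matrix.mulVec ((gate j (readBit 1 x j))⁻¹.permMatrix ℂ) (P.state x j) = _
      rw [ih, Matrix.permMatrix_mulVec]
      ext v
      simp [permRun, Pi.single_apply, Equiv.symm_apply_eq]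
  refine ⟨m, P, rfl, hW, computesWithMargin_of_indicator (fun x => ?_) hε⟩
  unfold QuantumOBDD.acceptProb
  rw [hrun]
  simp only [hf x]
  rw [← Finset.sum_pi_single (permRun gate source x (k * n)) (fun _ => (1 : ℝ)) acc]
  refine Finset.sum_congr rfl fun i _ => ?_
  by_cases h : i = permRun gate source x (k * n) <;> simp [h]

end PermPrograms

/-- A function computed by permutations of a set of states belongs to all four classes. -/
theorem mem_classes_of_permRun {k n : ℕ} {σ : Type*} [Fintype σ] [DecidableEq σ]
    (gate : ℕ → Bool → Equiv.Perm σ) (source : σ) (acc : Finset σ) {f : (Fin n → Bool) → Bool}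
    (hf : ∀ x, f x = true ↔ permRun gate source x (k * n) ∈ acc) {W : ℝ}
    (hW : (Fintype.card σ : ℝ) ≤ W) :
    f ∈ classIdOBDD k n W ∧ f ∈ classIdNOBDD k n W ∧
      ∀ ε : ℝ, 0 < ε → ε ≤ 1 / 2 → f ∈ classIdPOBDD k n ε W ∧ f ∈ classIdQOBDD k n ε W := by
  let e := Fintype.equivFin σ
  let gate' : ℕ → Bool → Equiv.Perm (Fin (Fintype.card σ)) := fun j b => e.permCongr (gate j b)
  have hrun : ∀ x : Fin n → Bool, ∀ j,
      permRun gate' (e source) x j = e (permRun gate source x j) := by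
    intro x j
    induction j with
    | zero => rfl
    | succ j ih => simp [permRun, ih, gate']
  have hf' : ∀ x, f x = true ↔
      permRun gate' (e source) x (k * n) ∈ acc.map e.toEmbedding := by
    intro x
    rw [hf x, hrun]
    simp
  exact ⟨mem_classIdOBDD_of_permRun _ _ _ hf' hW, mem_classIdNOBDD_of_permRun _ _ _ hf' hW,
    fun ε _ hε => ⟨mem_classIdPOBDD_of_permRun _ _ _ hf' hW hε,
      mem_classIdQOBDD_of_permRun _ _ _ hf' hW hε⟩⟩

/-! ### Rows that have to be told apart -/

/-- The inputs `a i`, restricted to the variables of `S`, give pairwise different subfunctions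
of `f`. -/
def RowsSeparated {n : ℕ} {ι : Type*} (f : (Fin n → Bool) → Bool) (S : Set (Fin n))
    (a : ι → Fin n → Bool) : Prop :=
  ∀ i j, i ≠ j → ∃ x y : Fin n → Bool, (∀ v ∈ S, x v = a i v) ∧ (∀ v ∈ S, y v = a j v) ∧
    (∀ v ∉ S, x v = y v) ∧ f x ≠ f y

/-- The variables that the order `π` tests at the first `s` steps of a layer. -/
def prefixSet {n : ℕ} (π : Equiv.Perm (Fin n)) (s : ℕ) : Set (Fin n) :=
  {v | (π.symm v : ℕ) < s}

lemma mem_prefixSet {n : ℕ} {π : Equiv.Perm (Fin n)} {s : ℕ} {v : Fin n} :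
    v ∈ prefixSet π s ↔ (π.symm v : ℕ) < s := Iff.rfl

section ReadBit

variable {n : ℕ} {π : Equiv.Perm (Fin n)} {x y : Fin n → Bool} {s : ℕ}

lemma readBit_layer (π : Equiv.Perm (Fin n)) (x : Fin n → Bool) (l : ℕ) {i : ℕ} (hi : i < n) :
    readBit π x (l * n + i) = x (π ⟨i, hi⟩) := by
  have hn : 0 < n := by omega
  have h : (l * n + i) % n = i := by
    rw [add_comm, Nat.add_mul_mod_self_right, Nat.mod_eq_of_lt hi]
  simp only [readBit, hn, dif_pos, h]

lemma readBit_congr_prefix (h : ∀ v ∈ prefixSet π s, x v = y v) (l : ℕ) {i : ℕ} (his : i < s)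
    (hin : i < n) : readBit π x (l * n + i) = readBit π y (l * n + i) := by
  rw [readBit_layer π x l hin, readBit_layer π y l hin]
  exact h _ (by simpa [prefixSet] using his)

lemma readBit_congr_suffix (h : ∀ v ∉ prefixSet π s, x v = y v) (l : ℕ) {i : ℕ} (his : s ≤ i)
    (hin : i < n) : readBit π x (l * n + i) = readBit π y (l * n + i) := by
  rw [readBit_layer π x l hin, readBit_layer π y l hin]
  exact h _ (by simpa [prefixSet] using his)

end ReadBit

/-! ### Deterministic programs -/

section Deterministic

variable {α : Type*}

/-- `m` steps, from level `i` on, of a program with the same set of nodes at each level. -/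
def iterSteps (g : ℕ → Bool → α → α) (bits : ℕ → Bool) (i : ℕ) : ℕ → α → α
  | 0 => id
  | m + 1 => fun q => g (i + m) (bits (i + m)) (iterSteps g bits i m q)

lemma iterSteps_add (g : ℕ → Bool → α → α) (bits : ℕ → Bool) (i m m' : ℕ) (q : α) :
    iterSteps g bits i (m + m') q = iterSteps g bits (i + m) m' (iterSteps g bits i m q) := by
  induction m' with
  | zero => rfl
  | succ m' ih =>
    rw [← add_assoc]
    simp only [iterSteps, ih, add_assoc]

lemma iterSteps_congr (g : ℕ → Bool → α → α) {bits bits' : ℕ → Bool} {i m : ℕ}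
    (h : ∀ r < m, bits (i + r) = bits' (i + r)) :
    iterSteps g bits i m = iterSteps g bits' i m := by
  induction m with
  | zero => rfl
  | succ m ih =>
    simp only [iterSteps]
    rw [ih fun r hr => h r (by omega), h m (by omega)]

/-- The cut argument: a run is the alternating composition of the maps induced by the two parts of
each layer, so the input enters only through these maps. -/
lemma iterSteps_layers_congr (g : ℕ → Bool → α → α) {bits bits' : ℕ → Bool} {k n s : ℕ}
    (hs : s ≤ n)
    (h₁ : ∀ l < k, iterSteps g bits (l * n) s = iterSteps g bits' (l * n) s)
    (h₂ : ∀ l < k, iterSteps g bits (l * n + s) (n - s) = iterSteps g bits' (l * n + s) (n - s)) :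
    iterSteps g bits 0 (k * n) = iterSteps g bits' 0 (k * n) := by
  suffices ∀ l ≤ k, iterSteps g bits 0 (l * n) = iterSteps g bits' 0 (l * n) from this k le_rfl
  intro l hl
  induction l with
  | zero => simp [iterSteps]
  | succ l ih =>
    funext q
    have e : (l + 1) * n = l * n + (s + (n - s)) := by rw [Nat.succ_mul]; omega
    rw [e, iterSteps_add, iterSteps_add, ih (by omega), iterSteps_add, iterSteps_add, zero_add,
      h₁ l (by omega), h₂ l (by omega)]

namespace DetOBDD

variable {k n w : ℕ}

lemma size_le (P : DetOBDD k n) (hw : P.width ≤ w) {j : ℕ} (hj : j < k * n) : P.size j ≤ w :=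
  le_trans (Finset.le_sup (f := P.size) (mem_range.2 hj)) hw

/-- The nodes of every level can be taken to be `0, …, w`. -/
lemma exists_uniform (P : DetOBDD k n) (hkn : 0 < k * n) (hw : P.width ≤ w)
    {f : (Fin n → Bool) → Bool} (hf : P.Computes f) :
    ∃ (g : ℕ → Bool → Fin (w + 1) → Fin (w + 1)) (q : Fin (w + 1)) (acc : Set (Fin (w + 1))),
      ∀ x, f x = true ↔ iterSteps g (readBit P.order x) 0 (k * n) q ∈ acc := by
  classical
  have hw1 : 1 ≤ w := le_trans (Nat.succ_le_of_lt (Fin.pos P.source)) (P.size_le hw hkn)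
  -- The width does not bound the level of the sinks, so the last step merges the sinks into `1`
  -- (accepting) and `0`. The extra node makes room for both when `w = 1`. Elsewhere `0` is a
  -- default for nodes that do not exist.
  let g : ℕ → Bool → Fin (w + 1) → Fin (w + 1) := fun j b q =>
    if h : (q : ℕ) < P.size j then
      if j + 1 = k * n then
        if ∃ v ∈ P.accept, (v : ℕ) = P.next j b ⟨q, h⟩ then Fin.ofNat _ 1 else 0
      else Fin.ofNat _ (P.next j b ⟨q, h⟩)
    else 0
  have hrun : ∀ x, ∀ j < k * n,
      ((iterSteps g (readBit P.order x) 0 j (Fin.ofNat _ P.source) : Fin (w + 1)) : ℕ) =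
        P.run x j := by
    intro x j hj
    induction j with
    | zero =>
      have := P.size_le hw hj
      have := P.source.2
      simp only [iterSteps, id, Fin.val_ofNat, run]
      exact Nat.mod_eq_of_lt (by omega)
    | succ j ih =>
      have ih := ih (by omega)
      have h1 := P.size_le hw hj
      simp only [iterSteps, zero_add, run]
      set q := iterSteps g (readBit P.order x) 0 j (Fin.ofNat _ P.source) with hq
      have hlt : (q : ℕ) < P.size j := by rw [ih]; exact (P.run x j).2
      have e : (⟨q, hlt⟩ : Fin (P.size j)) = P.run x j := Fin.ext ih
      simp only [g, dif_pos hlt, if_neg (show j + 1 ≠ k * n by omega), e, Fin.val_ofNat]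
      refine Nat.mod_eq_of_lt ?_
      have := (P.next j (readBit P.order x j) (P.run x j)).2
      omega
  refine ⟨g, Fin.ofNat _ P.source, {q | (q : ℕ) = 1}, fun x => ?_⟩
  obtain ⟨j, hj⟩ : ∃ j, k * n = j + 1 := ⟨k * n - 1, by omega⟩
  have hr := hrun x j (by omega)
  rw [hf x]
  have hacc : P.run x (k * n) ∈ P.accept ↔
      ∃ v ∈ P.accept, (v : ℕ) = P.run x (j + 1) := by
    have hval : ∀ i i', i = i' → (P.run x i : ℕ) = P.run x i' := by rintro i _ rfl; rfl
    rw [← hval _ _ hj]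
    refine ⟨fun h => ⟨_, h, rfl⟩, ?_⟩
    rintro ⟨v, hv, e⟩
    rwa [← Fin.ext e]
  rw [hacc, show iterSteps g (readBit P.order x) 0 (k * n) =
    iterSteps g (readBit P.order x) 0 (j + 1) by rw [hj]]
  simp only [iterSteps, zero_add, run]
  set q := iterSteps g (readBit P.order x) 0 j (Fin.ofNat _ P.source) with hq
  have hlt : (q : ℕ) < P.size j := by rw [hr]; exact (P.run x j).2
  have e : (⟨q, hlt⟩ : Fin (P.size j)) = P.run x j := Fin.ext hr
  simp only [g, dif_pos hlt, if_pos hj.symm, e, Set.mem_ofPred_eq]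
  split_ifs with h
  · simp only [h, true_iff, Fin.val_ofNat]
    exact Nat.mod_eq_of_lt (by omega)
  · simp [h]

/-- A program of width `w` tells apart at most `(w + 1) ^ ((w + 1) * k)` rows. -/
theorem card_rows_le (P : DetOBDD k n) (hkn : 0 < k * n) (hw : P.width ≤ w)
    {f : (Fin n → Bool) → Bool} (hf : P.Computes f) {ι : Type*} [Fintype ι]
    {a : ι → Fin n → Bool} {s : ℕ} (hs : s ≤ n)
    (ha : RowsSeparated f (prefixSet P.order s) a ∨ RowsSeparated f (prefixSet P.order s)ᶜ a) :
    Fintype.card ι ≤ (w + 1) ^ ((w + 1) * k) := by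
  classical
  by_contra! hlt
  obtain ⟨g, q, acc, hg⟩ := P.exists_uniform hkn hw hf
  have hcard : Fintype.card (Fin k → Fin (w + 1) → Fin (w + 1)) = (w + 1) ^ ((w + 1) * k) := by
    simp [pow_mul]
  have hne : ∀ x y : Fin n → Bool, f x ≠ f y →
      iterSteps g (readBit P.order x) 0 (k * n) ≠ iterSteps g (readBit P.order y) 0 (k * n) := by
    intro x y hxy he
    refine hxy (Bool.eq_iff_iff.2 ?_)
    rw [hg x, hg y, he]
  rcases ha with ha | ha
  -- Pigeonhole on the `k` maps induced before the cut; behind the cut the two inputs read the same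
  -- bits. The second case exchanges the roles of the two sides.
  · obtain ⟨i, j, hij, he⟩ := Fintype.exists_ne_map_eq_of_card_lt
      (fun i (l : Fin k) => iterSteps g (readBit P.order (a i)) (l * n) s) (by rwa [hcard])
    obtain ⟨x, y, hx, hy, hxy, hfxy⟩ := ha i j hij
    refine hne x y hfxy (iterSteps_layers_congr g hs (fun l hl => ?_) fun l hl => ?_)
    · rw [iterSteps_congr g fun r hr => readBit_congr_prefix hx l hr (by omega),
        iterSteps_congr g (bits := readBit P.order y) fun r hr =>
          readBit_congr_prefix hy l hr (by omega)]
      exact congrFun he ⟨l, hl⟩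
    · refine iterSteps_congr g fun r hr => ?_
      rw [add_assoc]
      exact readBit_congr_suffix hxy l (by omega) (by omega)
  · obtain ⟨i, j, hij, he⟩ := Fintype.exists_ne_map_eq_of_card_lt
      (fun i (l : Fin k) => iterSteps g (readBit P.order (a i)) (l * n + s) (n - s))
      (by rwa [hcard])
    obtain ⟨x, y, hx, hy, hxy, hfxy⟩ := ha i j hij
    refine hne x y hfxy (iterSteps_layers_congr g hs (fun l hl => ?_) fun l hl => ?_)
    · exact iterSteps_congr g fun r hr =>
        readBit_congr_prefix (fun v hv => hxy v (by simpa using hv)) l hr (by omega)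
    · have key : ∀ z b : Fin n → Bool, (∀ v ∈ (prefixSet P.order s)ᶜ, z v = b v) →
          iterSteps g (readBit P.order z) (l * n + s) (n - s) =
            iterSteps g (readBit P.order b) (l * n + s) (n - s) := by
        intro z b hz
        refine iterSteps_congr g fun r hr => ?_
        rw [add_assoc]
        exact readBit_congr_suffix hz l (by omega) (by omega)
      rw [key x _ hx, key y _ hy]
      exact congrFun he ⟨l, hl⟩

end DetOBDD

end Deterministic

/-! ### Nondeterministic programs -/

namespace NondetOBDD

variable {k n w : ℕ}

lemma size_le (P : NondetOBDD k n) (hw : P.width ≤ w) {j : ℕ} (hj : j < k * n) : P.size j ≤ w :=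
  le_trans (Finset.le_sup (f := P.size) (mem_range.2 hj)) hw

/-- The nodes of level `i + m` that can be reached from a node of level `i`. -/
def seg (P : NondetOBDD k n) (bits : ℕ → Bool) (i : ℕ) :
    (m : ℕ) → Fin (P.size i) → Set (Fin (P.size (i + m)))
  | 0 => fun u => {u}
  | m + 1 => fun u => {v | ∃ u' ∈ P.seg bits i m u, P.edge (i + m) (bits (i + m)) u' v}

lemma reach_add (P : NondetOBDD k n) (x : Fin n → Bool) (i m : ℕ) :
    P.reach x (i + m) = {v | ∃ u ∈ P.reach x i, v ∈ P.seg (readBit P.order x) i m u} := by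
  induction m with
  | zero => ext v; simp [seg]
  | succ m ih =>
    change {v | ∃ u ∈ P.reach x (i + m), P.edge (i + m) _ u v} = _
    rw [ih]
    ext v
    simp only [seg, Set.mem_ofPred_eq]
    constructor
    · rintro ⟨u', ⟨u, hu, huu'⟩, hv⟩
      exact ⟨u, hu, u', huu', hv⟩
    · rintro ⟨u, hu, u', huu', hv⟩
      exact ⟨u', ⟨u, hu, huu'⟩, hv⟩

lemma seg_congr (P : NondetOBDD k n) {bits bits' : ℕ → Bool} {i m : ℕ}
    (h : ∀ r < m, bits (i + r) = bits' (i + r)) : P.seg bits i m = P.seg bits' i m := by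
  induction m with
  | zero => rfl
  | succ m ih =>
    simp only [seg]
    rw [ih fun r hr => h r (by omega), h m (by omega)]

/-- A program of width `w` tells apart at most `2 ^ (k * w ^ 2)` rows. -/
theorem card_rows_le (P : NondetOBDD k n) (hw : P.width ≤ w)
    {f : (Fin n → Bool) → Bool} (hf : P.Computes f) {ι : Type*} [Fintype ι]
    {a : ι → Fin n → Bool} {s : ℕ} (hs : s < n) (ha : RowsSeparated f (prefixSet P.order s) a) :
    Fintype.card ι ≤ 2 ^ (k * w ^ 2) := by
  classical
  by_contra! hlt
  let J := Σ l : Fin k, Fin (P.size (l * n)) × Fin (P.size (l * n + s))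
  -- Since `s < n`, the cut of the last layer also lies below the sinks, whose number the width does
  -- not control.
  have hlevel : ∀ l < k, l * n + s < k * n := fun l hl =>
    calc l * n + s < l * n + n := by omega
      _ = (l + 1) * n := by ring
      _ ≤ k * n := Nat.mul_le_mul_right n hl
  have hJ : Fintype.card J ≤ k * w ^ 2 := by
    simp only [J, Fintype.card_sigma, Fintype.card_prod, Fintype.card_fin]
    refine (Finset.sum_le_card_nsmul univ _ (w ^ 2) fun l _ => ?_).trans (by simp)
    have h := hlevel l l.2
    rw [sq]
    exact Nat.mul_le_mul (P.size_le hw (by omega)) (P.size_le hw h)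
  have hcard : Fintype.card (Set J) < Fintype.card ι := by
    rw [Fintype.card_set]
    exact (Nat.pow_le_pow_right two_pos hJ).trans_lt hlt
  obtain ⟨i, j, hij, he⟩ := Fintype.exists_ne_map_eq_of_card_lt
    (fun i => {p : J | p.2.2 ∈ P.seg (readBit P.order (a i)) (p.1 * n) s p.2.1}) hcard
  obtain ⟨x, y, hx, hy, hxy, hfxy⟩ := ha i j hij
  have hlayer : ∀ l ≤ k, P.reach x (l * n) = P.reach y (l * n) := by
    intro l hl
    induction l with
    | zero => rw [zero_mul]; rfl
    | succ l ih =>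
      have hA : P.reach x (l * n + s) = P.reach y (l * n + s) := by
        rw [reach_add, reach_add, ih (by omega),
          P.seg_congr fun r hr => readBit_congr_prefix hx l hr (by omega),
          P.seg_congr (bits := readBit P.order y) fun r hr =>
            readBit_congr_prefix hy l hr (by omega)]
        ext v
        simp only [Set.mem_ofPred_eq]
        refine exists_congr fun u => and_congr_right fun _ => ?_
        exact Set.ext_iff.1 he (⟨⟨l, hl⟩, u, v⟩ : J)
      have hB : P.reach x (l * n + s + (n - s)) = P.reach y (l * n + s + (n - s)) := by
        rw [P.reach_add x (l * n + s), P.reach_add y (l * n + s), hA, P.seg_congr fun r hr => ?_]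
        rw [add_assoc]
        exact readBit_congr_suffix hxy l (by omega) (by omega)
      have e : l * n + s + (n - s) = (l + 1) * n := by rw [Nat.succ_mul]; omega
      rwa [e] at hB
  refine hfxy (Bool.eq_iff_iff.2 ?_)
  rw [hf x, hf y, hlayer k le_rfl]

end NondetOBDD

/-! ### Rounding -/

/-- Among more than `(2 * N + 1) ^ #J` points of the cube `[-1, 1] ^ J`, two are at distance at most
`1 / N` in each coordinate. -/
lemma exists_close_of_card_lt {ι J : Type*} [Fintype ι] [Fintype J] (F : ι → J → ℝ)
    (hF : ∀ i j, |F i j| ≤ 1) {N : ℕ} (hN : 0 < N)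
    (hcard : (2 * N + 1) ^ Fintype.card J < Fintype.card ι) :
    ∃ i i', i ≠ i' ∧ ∀ j, |F i j - F i' j| ≤ 1 / N := by
  classical
  have hN' : (0 : ℝ) < N := by exact_mod_cast hN
  have hlt : ∀ i j, ⌊(F i j + 1) * N⌋₊ < 2 * N + 1 := by
    intro i j
    have h := abs_le.1 (hF i j)
    rw [Nat.floor_lt (by nlinarith)]
    push_cast
    nlinarith
  obtain ⟨i, i', hne, he⟩ := Fintype.exists_ne_map_eq_of_card_lt
    (fun i (j : J) => (⟨⌊(F i j + 1) * N⌋₊, hlt i j⟩ : Fin (2 * N + 1))) (by simpa using hcard)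
  refine ⟨i, i', hne, fun j => ?_⟩
  have h0 : ∀ i, 0 ≤ (F i j + 1) * N := fun i => by
    have h := abs_le.1 (hF i j)
    nlinarith
  have e : ⌊(F i j + 1) * N⌋₊ = ⌊(F i' j + 1) * N⌋₊ := congrArg Fin.val (congrFun he j)
  have h1 := Nat.floor_le (h0 i)
  have h2 := Nat.lt_floor_add_one ((F i j + 1) * N)
  have h3 := Nat.floor_le (h0 i')
  have h4 := Nat.lt_floor_add_one ((F i' j + 1) * N)
  rw [e] at h1 h2
  rw [abs_le, ← neg_div, div_le_iff₀ hN', le_div_iff₀ hN']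
  constructor <;> linarith

lemma ComputesWithMargin.two_mul_le_abs_sub {n : ℕ} {ε : ℝ} {p : (Fin n → Bool) → ℝ}
    {f : (Fin n → Bool) → Bool} (h : ComputesWithMargin ε p f) {x y : Fin n → Bool}
    (hxy : f x ≠ f y) : 2 * ε ≤ |p x - p y| := by
  cases hx : f x <;> cases hy : f y
  · exact absurd (hx.trans hy.symm) hxy
  · have := (h x).2 hx
    have := (h y).1 hy
    rw [abs_sub_comm]
    exact le_trans (by linarith) (le_abs_self _)
  · have := (h x).1 hx
    have := (h y).2 hy
    exact le_trans (by linarith) (le_abs_self _)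
  · exact absurd (hx.trans hy.symm) hxy

/-! ### Probabilistic programs -/

section Stochastic

variable {p q : Type*} [Fintype p] [Fintype q]

/-- For stochastic `M` and `c = 1` this says that the ℓ¹ distance does not grow; for a difference of
stochastic matrices it measures the effect of rounding. -/
lemma sum_abs_vecMul_le (v : p → ℝ) (M : Matrix p q ℝ) {c : ℝ}
    (hM : ∀ i, ∑ j, |M i j| ≤ c) : ∑ j, |Matrix.vecMul v M j| ≤ (∑ i, |v i|) * c := by
  calc ∑ j, |Matrix.vecMul v M j| ≤ ∑ j, ∑ i, |v i| * |M i j| := by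
        refine sum_le_sum fun j _ => ?_
        simp only [Matrix.vecMul, dotProduct, ← abs_mul]
        exact abs_sum_le_sum_abs _ _
    _ = ∑ i, |v i| * ∑ j, |M i j| := by
        rw [sum_comm]
        simp only [mul_sum]
    _ ≤ (∑ i, |v i|) * c := by
        rw [sum_mul]
        exact sum_le_sum fun i _ => mul_le_mul_of_nonneg_left (hM i) (abs_nonneg _)

end Stochastic

namespace ProbOBDD

variable {k n w : ℕ}

lemma size_le (P : ProbOBDD k n) (hw : P.width ≤ w) {j : ℕ} (hj : j < k * n) : P.size j ≤ w :=
  le_trans (Finset.le_sup (f := P.size) (mem_range.2 hj)) hw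

/-- The transition probabilities between the levels `i` and `i + m`. -/
def seg (P : ProbOBDD k n) (bits : ℕ → Bool) (i : ℕ) :
    (m : ℕ) → Matrix (Fin (P.size i)) (Fin (P.size (i + m))) ℝ
  | 0 => (1 : Matrix (Fin (P.size i)) (Fin (P.size i)) ℝ)
  | m + 1 => P.seg bits i m * P.trans (i + m) (bits (i + m))

lemma dist_add (P : ProbOBDD k n) (x : Fin n → Bool) (i m : ℕ) :
    P.dist x (i + m) = Matrix.vecMul (P.dist x i) (P.seg (readBit P.order x) i m) := by
  induction m with
  | zero => simp [seg]
  | succ m ih =>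
    change Matrix.vecMul (P.dist x (i + m)) _ = _
    rw [ih, Matrix.vecMul_vecMul]
    rfl

lemma seg_congr (P : ProbOBDD k n) {bits bits' : ℕ → Bool} {i m : ℕ}
    (h : ∀ r < m, bits (i + r) = bits' (i + r)) : P.seg bits i m = P.seg bits' i m := by
  induction m with
  | zero => rfl
  | succ m ih =>
    simp only [seg]
    rw [ih fun r hr => h r (by omega), h m (by omega)]

lemma seg_nonneg (P : ProbOBDD k n) (bits : ℕ → Bool) {i m : ℕ} (h : i + m ≤ k * n)
    (u : Fin (P.size i)) (v : Fin (P.size (i + m))) : 0 ≤ P.seg bits i m u v := by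
  induction m with
  | zero =>
    change 0 ≤ (1 : Matrix (Fin (P.size i)) (Fin (P.size i)) ℝ) u v
    rw [Matrix.one_apply]
    split_ifs <;> norm_num
  | succ m ih =>
    change 0 ≤ ∑ u', P.seg bits i m u u' * P.trans (i + m) (bits (i + m)) u' v
    exact sum_nonneg fun u' _ => mul_nonneg (ih (by omega) u')
      (P.trans_nonneg (i + m) (by omega) _ u' v)

lemma seg_sum (P : ProbOBDD k n) (bits : ℕ → Bool) {i m : ℕ} (h : i + m ≤ k * n)
    (u : Fin (P.size i)) : ∑ v, P.seg bits i m u v = 1 := by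
  induction m with
  | zero =>
    change ∑ v, (1 : Matrix (Fin (P.size i)) (Fin (P.size i)) ℝ) u v = 1
    simp [Matrix.one_apply]
  | succ m ih =>
    change ∑ v, ∑ u', P.seg bits i m u u' * P.trans (i + m) (bits (i + m)) u' v = 1
    rw [sum_comm]
    simp only [← mul_sum]
    rw [← ih (by omega)]
    exact sum_congr rfl fun u' _ => by
      rw [P.trans_sum (i + m) (by omega) (bits (i + m)) u', mul_one]

lemma seg_abs_sum (P : ProbOBDD k n) (bits : ℕ → Bool) {i m : ℕ} (h : i + m ≤ k * n)
    (u : Fin (P.size i)) : ∑ v, |P.seg bits i m u v| = 1 := by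
  rw [← P.seg_sum bits h u]
  exact sum_congr rfl fun v _ => abs_of_nonneg (P.seg_nonneg bits h u v)

lemma seg_abs_le_one (P : ProbOBDD k n) (bits : ℕ → Bool) {i m : ℕ} (h : i + m ≤ k * n)
    (u : Fin (P.size i)) (v : Fin (P.size (i + m))) : |P.seg bits i m u v| ≤ 1 := by
  rw [← P.seg_abs_sum bits h u]
  exact single_le_sum (f := fun v => |P.seg bits i m u v|) (fun _ _ => abs_nonneg _) (mem_univ v)

lemma dist_abs_sum_le (P : ProbOBDD k n) (x : Fin n → Bool) {j : ℕ} (h : j ≤ k * n) :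
    ∑ v, |P.dist x j v| ≤ 1 := by
  induction j with
  | zero =>
    refine le_of_eq ?_
    change ∑ v, |(Pi.single P.source 1 : Fin (P.size 0) → ℝ) v| = 1
    rw [sum_eq_single P.source] <;> simp +contextual
  | succ j ih =>
    refine (sum_abs_vecMul_le (P.dist x j) _ (c := 1) fun u => le_of_eq ?_).trans ?_
    · rw [← P.trans_sum j (by omega) (readBit P.order x j) u]
      exact sum_congr rfl fun v _ => abs_of_nonneg (P.trans_nonneg j (by omega) _ u v)
    · rw [mul_one]
      exact ih (by omega)

lemma sum_dist_sub_le_of_seg_eq (P : ProbOBDD k n) (x y : Fin n → Bool) {i m : ℕ}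
    (h : i + m ≤ k * n) (he : P.seg (readBit P.order x) i m = P.seg (readBit P.order y) i m) :
    ∑ v, |P.dist x (i + m) v - P.dist y (i + m) v| ≤ ∑ v, |P.dist x i v - P.dist y i v| := by
  rw [dist_add, dist_add, he]
  have := sum_abs_vecMul_le (P.dist x i - P.dist y i) (P.seg (readBit P.order y) i m) (c := 1)
    fun u => (P.seg_abs_sum _ h u).le
  rw [Matrix.sub_vecMul, mul_one] at this
  exact this

/-- With distributions `p`, `q` and transitions `A`, `B`, write `pA - qB = (p - q)A + q(A - B)`: the
first term is contracted, the second is at most `c` because `q` has mass at most one. -/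
lemma sum_dist_sub_le_of_seg_close (P : ProbOBDD k n) (x y : Fin n → Bool) {i m : ℕ} {c : ℝ}
    (h : i + m ≤ k * n) (he : ∀ u, ∑ v,
      |P.seg (readBit P.order x) i m u v - P.seg (readBit P.order y) i m u v| ≤ c) (hc : 0 ≤ c) :
    ∑ v, |P.dist x (i + m) v - P.dist y (i + m) v| ≤ ∑ v, |P.dist x i v - P.dist y i v| + c := by
  set A := P.seg (readBit P.order x) i m with hA
  set B := P.seg (readBit P.order y) i m with hB
  have h1 := sum_abs_vecMul_le (P.dist x i - P.dist y i) A (c := 1)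
    fun u => (P.seg_abs_sum _ h u).le
  have h2 := sum_abs_vecMul_le (P.dist y i) (A - B) he
  have h3 : (∑ v, |P.dist y i v|) * c ≤ 1 * c :=
    mul_le_mul_of_nonneg_right (P.dist_abs_sum_le y (by omega)) hc
  rw [mul_one] at h1
  rw [one_mul] at h3
  calc ∑ v, |P.dist x (i + m) v - P.dist y (i + m) v|
      ≤ ∑ v, (|Matrix.vecMul (P.dist x i - P.dist y i) A v| +
          |Matrix.vecMul (P.dist y i) (A - B) v|) := by
        refine sum_le_sum fun v _ => ?_
        rw [dist_add, dist_add, ← hA, ← hB, Matrix.sub_vecMul, Matrix.vecMul_sub]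
        refine le_trans (le_of_eq ?_) (abs_add_le _ _)
        simp
    _ ≤ _ := by
        rw [sum_add_distrib]
        exact add_le_add h1 (h2.trans h3)

/-- A program of width `w` with margin `ε` tells apart at most
`(2 * N + 1) ^ ((k - 1) * w ^ 2 + w)` rows, if `N` is large enough. -/
theorem card_rows_le (P : ProbOBDD k n) (hw : P.width ≤ w) {ε : ℝ}
    {f : (Fin n → Bool) → Bool} (hf : ComputesWithMargin ε P.acceptProb f)
    {ι : Type*} [Fintype ι] {a : ι → Fin n → Bool} {s : ℕ} (hs : s < n) (hk : 0 < k)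
    (ha : RowsSeparated f (prefixSet P.order s) a) {N : ℕ} (hN : 0 < N)
    (hNε : (k * w : ℝ) / N < 2 * ε) :
    Fintype.card ι ≤ (2 * N + 1) ^ ((k - 1) * w ^ 2 + w) := by
  classical
  by_contra! hlt
  have hlevel : ∀ l < k, l * n + s < k * n := fun l hl =>
    calc l * n + s < l * n + n := by omega
      _ = (l + 1) * n := by ring
      _ ≤ k * n := Nat.mul_le_mul_right n hl
  -- The first layer starts at the fixed source, so there a vector of `w` entries replaces a matrix
  -- of `w ^ 2`. With `k` full matrices the final comparison would fail for `k = 2` and `w ^ 2`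
  -- close to `d`.
  let J₁ := Σ l : Fin (k - 1), Fin (P.size ((l + 1) * n)) × Fin (P.size ((l + 1) * n + s))
  let J := J₁ ⊕ Fin (P.size (0 * n + s))
  have hJ : Fintype.card J ≤ (k - 1) * w ^ 2 + w := by
    simp only [J, J₁, Fintype.card_sum, Fintype.card_sigma, Fintype.card_prod, Fintype.card_fin]
    refine add_le_add ?_ (P.size_le hw (hlevel 0 hk))
    refine (Finset.sum_le_card_nsmul univ _ (w ^ 2) fun l _ => ?_).trans (by simp)
    have h := hlevel (l + 1) (by omega)
    rw [sq]
    exact Nat.mul_le_mul (P.size_le hw (by omega)) (P.size_le hw h)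
  let F : ι → J → ℝ := fun i => Sum.elim
    (fun p => P.seg (readBit P.order (a i)) ((p.1 + 1) * n) s p.2.1 p.2.2)
    (P.dist (a i) (0 * n + s))
  have hF : ∀ i j, |F i j| ≤ 1 := by
    rintro i (⟨l, u, v⟩ | v)
    · have h := hlevel (l + 1) (by omega)
      exact P.seg_abs_le_one _ h.le u v
    · exact (single_le_sum (f := fun v => |P.dist (a i) (0 * n + s) v|) (fun _ _ => abs_nonneg _)
        (mem_univ v)).trans (P.dist_abs_sum_le _ (hlevel 0 hk).le)
  obtain ⟨i, j, hij, he⟩ := exists_close_of_card_lt F hF hN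
    ((Nat.pow_le_pow_right (by omega) hJ).trans_lt hlt)
  obtain ⟨x, y, hx, hy, hxy, hfxy⟩ := ha i j hij
  have hsx : ∀ l, P.seg (readBit P.order x) (l * n) s = P.seg (readBit P.order (a i)) (l * n) s :=
    fun l => P.seg_congr fun r hr => readBit_congr_prefix hx l hr (by omega)
  have hsy : ∀ l, P.seg (readBit P.order y) (l * n) s = P.seg (readBit P.order (a j)) (l * n) s :=
    fun l => P.seg_congr fun r hr => readBit_congr_prefix hy l hr (by omega)
  have hN0 : (0 : ℝ) < N := by exact_mod_cast hN
  have hsum : ∀ l < k, ∀ g : Fin (P.size (l * n + s)) → ℝ, (∀ v, g v ≤ 1 / N) →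
      ∑ v, g v ≤ w / N := by
    intro l hl g hg
    refine (Finset.sum_le_card_nsmul univ _ _ fun v _ => hg v).trans ?_
    rw [card_univ, Fintype.card_fin, nsmul_eq_mul, mul_one_div]
    gcongr
    exact P.size_le hw (hlevel l hl)
  have hdist0 : ∀ z : Fin n → Bool, ∀ b, (∀ v ∈ prefixSet P.order s, z v = b v) →
      P.dist z (0 * n + s) = P.dist b (0 * n + s) := by
    intro z b hz
    rw [dist_add, dist_add, P.seg_congr fun r hr => readBit_congr_prefix hz 0 hr (by omega)]
    congr 1
    rw [zero_mul]
    rfl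
  have hB : ∀ l < k, ∑ v, |P.dist x ((l + 1) * n) v - P.dist y ((l + 1) * n) v| ≤
      ∑ v, |P.dist x (l * n + s) v - P.dist y (l * n + s) v| := by
    intro l hl
    have e : l * n + s + (n - s) = (l + 1) * n := by rw [Nat.succ_mul]; omega
    have h := P.sum_dist_sub_le_of_seg_eq x y (i := l * n + s) (m := n - s)
      (by rw [e]; exact Nat.mul_le_mul_right n hl) (P.seg_congr fun r hr => by
        rw [add_assoc]
        exact readBit_congr_suffix hxy l (by omega) (by omega))
    rwa [e] at h
  -- Each part before the cut adds at most `w / N` to the ℓ¹ distance; the parts behind the cut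
  -- coincide and add nothing.
  have hA : ∀ l < k, ∑ v, |P.dist x (l * n + s) v - P.dist y (l * n + s) v| ≤
      (l + 1) * (w / N) := by
    intro l hl
    induction l with
    | zero =>
      rw [Nat.cast_zero, zero_add, one_mul, hdist0 x _ hx, hdist0 y _ hy]
      exact hsum 0 hl _ fun v => he (Sum.inr v)
    | succ l ih =>
      refine (P.sum_dist_sub_le_of_seg_close x y (hlevel _ hl).le (c := w / N) (fun u => ?_)
        (by positivity)).trans ?_
      · rw [hsx, hsy]
        exact hsum _ hl _ fun v => he (Sum.inl ⟨⟨l, by omega⟩, u, v⟩)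
      · have := (hB l (by omega)).trans (ih (by omega))
        push_cast
        linarith
  have hfin : ∑ v, |P.dist x (k * n) v - P.dist y (k * n) v| ≤ k * (w / N) := by
    obtain ⟨l, rfl⟩ : ∃ l, k = l + 1 := ⟨k - 1, by omega⟩
    have := (hB l (by omega)).trans (hA l (by omega))
    exact_mod_cast this
  have hgap := hf.two_mul_le_abs_sub hfxy
  have : |P.acceptProb x - P.acceptProb y| ≤ ∑ v, |P.dist x (k * n) v - P.dist y (k * n) v| := by
    unfold acceptProb
    rw [← sum_sub_distrib]
    exact (abs_sum_le_sum_abs _ _).trans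
      (sum_le_sum_of_subset_of_nonneg (subset_univ _) fun _ _ _ => abs_nonneg _)
  rw [mul_div_assoc] at hNε
  linarith

end ProbOBDD

/-! ### Quantum programs -/

section Unitary

variable {w : ℕ}

/-- The Euclidean norm of a state vector. -/
noncomputable def stateNorm (v : Fin w → ℂ) : ℝ :=
  ‖(WithLp.toLp 2 v : EuclideanSpace ℂ (Fin w))‖

lemma stateNorm_sq (v : Fin w → ℂ) : stateNorm v ^ 2 = ∑ i, ‖v i‖ ^ 2 := by
  rw [stateNorm, EuclideanSpace.norm_sq_eq]

lemma stateNorm_nonneg (v : Fin w → ℂ) : 0 ≤ stateNorm v := norm_nonneg _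

lemma stateNorm_add_le (u v : Fin w → ℂ) : stateNorm (u + v) ≤ stateNorm u + stateNorm v := by
  simp only [stateNorm, WithLp.toLp_add]
  exact norm_add_le _ _

lemma norm_le_stateNorm (v : Fin w → ℂ) (i : Fin w) : ‖v i‖ ≤ stateNorm v := by
  refine le_of_sq_le_sq ?_ (stateNorm_nonneg v)
  rw [stateNorm_sq]
  exact single_le_sum (f := fun i => ‖v i‖ ^ 2) (fun _ _ => sq_nonneg _) (mem_univ i)

lemma stateNorm_le_sum (v : Fin w → ℂ) : stateNorm v ≤ ∑ i, ‖v i‖ := by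
  refine le_of_sq_le_sq ?_ (sum_nonneg fun _ _ => norm_nonneg _)
  rw [stateNorm_sq]
  rw [sq (∑ i, ‖v i‖), sum_mul]
  refine sum_le_sum fun i _ => ?_
  rw [sq]
  exact mul_le_mul_of_nonneg_left
    (single_le_sum (f := fun i => ‖v i‖) (fun _ _ => norm_nonneg _) (mem_univ i)) (norm_nonneg _)

lemma stateNorm_mulVec {U : Matrix (Fin w) (Fin w) ℂ} (hU : U ∈ Matrix.unitaryGroup (Fin w) ℂ)
    (v : Fin w → ℂ) : stateNorm (U.mulVec v) = stateNorm v := by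
  have h : ∀ v : Fin w → ℂ, ((stateNorm v ^ 2 : ℝ) : ℂ) = star v ⬝ᵥ v := by
    intro v
    rw [stateNorm_sq]
    simp [dotProduct, Complex.conj_mul']
  have h2 : stateNorm (U.mulVec v) ^ 2 = stateNorm v ^ 2 := by
    refine Complex.ofReal_injective ?_
    rw [h, h, Matrix.star_mulVec, Matrix.dotProduct_mulVec, Matrix.vecMul_vecMul,
      ← Matrix.star_eq_conjTranspose, Matrix.mem_unitaryGroup_iff'.1 hU, Matrix.vecMul_one]
  exact (sq_eq_sq₀ (stateNorm_nonneg _) (stateNorm_nonneg _)).1 h2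

end Unitary

namespace QuantumOBDD

variable {k n w : ℕ}

/-- The product of the gates applied at the `m` steps from step `i` on. -/
def seg (P : QuantumOBDD k n w) (bits : ℕ → Bool) (i : ℕ) : ℕ → Matrix.unitaryGroup (Fin w) ℂ
  | 0 => 1
  | m + 1 => P.gate (i + m) (bits (i + m)) * P.seg bits i m

lemma state_add (P : QuantumOBDD k n w) (x : Fin n → Bool) (i m : ℕ) :
    P.state x (i + m) =
      (P.seg (readBit P.order x) i m : Matrix (Fin w) (Fin w) ℂ).mulVec (P.state x i) := by
  induction m with
  | zero => simp [seg]
  | succ m ih =>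
    change Matrix.mulVec _ (P.state x (i + m)) = _
    rw [ih, Matrix.mulVec_mulVec]
    rfl

lemma seg_congr (P : QuantumOBDD k n w) {bits bits' : ℕ → Bool} {i m : ℕ}
    (h : ∀ r < m, bits (i + r) = bits' (i + r)) : P.seg bits i m = P.seg bits' i m := by
  induction m with
  | zero => rfl
  | succ m ih =>
    simp only [seg]
    rw [ih fun r hr => h r (by omega), h m (by omega)]

lemma stateNorm_state (P : QuantumOBDD k n w) (x : Fin n → Bool) (j : ℕ) :
    stateNorm (P.state x j) = 1 := by
  induction j with
  | zero =>
    refine (pow_eq_one_iff_of_nonneg (stateNorm_nonneg _) two_ne_zero).1 ?_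
    rw [stateNorm_sq, sum_eq_single P.source] <;> simp +contextual [state]
  | succ j ih =>
    exact (stateNorm_mulVec (P.gate j (readBit P.order x j)).2 _).trans ih

/-- `Uψ - Vφ = U(ψ - φ) + (U - V)φ`, where `U` is an isometry and `φ` a unit vector. The factor `w ^
2` is the crude sum over all entries; a power of `w` costs only a constant factor in the exponent of
the count. -/
lemma stateNorm_sub_le_of_seg_close (P : QuantumOBDD k n w) (x y : Fin n → Bool) {i m : ℕ} {c : ℝ}
    (hc : ∀ u v, ‖(P.seg (readBit P.order x) i m : Matrix (Fin w) (Fin w) ℂ) u v -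
      (P.seg (readBit P.order y) i m : Matrix (Fin w) (Fin w) ℂ) u v‖ ≤ c) :
    stateNorm (P.state x (i + m) - P.state y (i + m)) ≤
      stateNorm (P.state x i - P.state y i) + w ^ 2 * c := by
  set U := (P.seg (readBit P.order x) i m : Matrix (Fin w) (Fin w) ℂ) with hU
  set V := (P.seg (readBit P.order y) i m : Matrix (Fin w) (Fin w) ℂ) with hV
  have e : P.state x (i + m) - P.state y (i + m) =
      U.mulVec (P.state x i - P.state y i) + (U - V).mulVec (P.state y i) := by
    rw [state_add, state_add, ← hU, ← hV, Matrix.mulVec_sub, Matrix.sub_mulVec]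
    abel
  rw [e]
  refine (stateNorm_add_le _ _).trans (add_le_add (stateNorm_mulVec (Subtype.prop _) _).le ?_)
  refine (stateNorm_le_sum _).trans ?_
  have h1 : ∀ u, ‖(U - V).mulVec (P.state y i) u‖ ≤ w * c := by
    intro u
    change ‖∑ v, (U - V) u v * P.state y i v‖ ≤ w * c
    refine (norm_sum_le _ _).trans ?_
    refine (sum_le_card_nsmul univ _ c fun v _ => ?_).trans (by simp)
    rw [norm_mul]
    have h := norm_le_stateNorm (P.state y i) v
    rw [stateNorm_state] at h
    exact (mul_le_of_le_one_right (norm_nonneg _) h).trans (hc u v)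
  refine (sum_le_card_nsmul univ _ _ fun u _ => h1 u).trans (le_of_eq ?_)
  simp
  ring

/-- In each of the `w` coordinates, `|a ^ 2 - b ^ 2| = (a + b) * |a - b|` with `a + b ≤ 2` for
moduli of entries of unit vectors. -/
lemma acceptProb_sub_le (P : QuantumOBDD k n w) (x y : Fin n → Bool) :
    |P.acceptProb x - P.acceptProb y| ≤
      2 * w * stateNorm (P.state x (k * n) - P.state y (k * n)) := by
  unfold acceptProb
  rw [← sum_sub_distrib]
  refine (abs_sum_le_sum_abs _ _).trans ((sum_le_sum_of_subset_of_nonneg (subset_univ _)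
    fun _ _ _ => abs_nonneg _).trans ?_)
  refine (sum_le_card_nsmul univ _
    (2 * stateNorm (P.state x (k * n) - P.state y (k * n))) fun v _ => ?_).trans (le_of_eq ?_)
  · have hx := norm_le_stateNorm (P.state x (k * n)) v
    have hy := norm_le_stateNorm (P.state y (k * n)) v
    rw [stateNorm_state] at hx hy
    have h := norm_le_stateNorm (P.state x (k * n) - P.state y (k * n)) v
    have h2 := abs_norm_sub_norm_le (P.state x (k * n) v) (P.state y (k * n) v)
    rw [sq_sub_sq, abs_mul, abs_of_nonneg (by positivity)]
    rw [Pi.sub_apply] at h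
    exact mul_le_mul (by linarith) (h2.trans h) (abs_nonneg _) (by norm_num)
  · simp
    ring

/-- A program of width `w` with margin `ε` tells apart at most `(2 * N + 1) ^ (2 * (k * w ^ 2))`
rows, if `N` is large enough. -/
theorem card_rows_le (P : QuantumOBDD k n w) {ε : ℝ}
    {f : (Fin n → Bool) → Bool} (hf : ComputesWithMargin ε P.acceptProb f)
    {ι : Type*} [Fintype ι] {a : ι → Fin n → Bool} {s : ℕ} (hs : s ≤ n)
    (ha : RowsSeparated f (prefixSet P.order s) a) {N : ℕ} (hN : 0 < N)
    (hNε : (4 * k * w ^ 3 : ℝ) / N < 2 * ε) :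
    Fintype.card ι ≤ (2 * N + 1) ^ (2 * (k * w ^ 2)) := by
  classical
  by_contra! hlt
  -- The Boolean selects the real or the imaginary part; rounding both accounts for the factor 2 in
  -- the exponent and for the distance `2 / N` of complex entries.
  let J := Bool × Fin k × Fin w × Fin w
  have hJ : Fintype.card J = 2 * (k * w ^ 2) := by
    simp only [J, Fintype.card_prod, Fintype.card_bool, Fintype.card_fin]
    ring
  let M : ι → ℕ → Matrix (Fin w) (Fin w) ℂ := fun i l => P.seg (readBit P.order (a i)) (l * n) s
  have hM : ∀ i l u v, ‖M i l u v‖ ≤ 1 := fun i l u v =>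
    entry_norm_bound_of_unitary (P.seg (readBit P.order (a i)) (l * n) s).2 u v
  let F : ι → J → ℝ := fun i p =>
    if p.1 then (M i p.2.1 p.2.2.1 p.2.2.2).re else (M i p.2.1 p.2.2.1 p.2.2.2).im
  have hF : ∀ i j, |F i j| ≤ 1 := by
    rintro i ⟨b, l, u, v⟩
    cases b
    · exact (Complex.abs_im_le_norm _).trans (hM i l u v)
    · exact (Complex.abs_re_le_norm _).trans (hM i l u v)
  obtain ⟨i, j, hij, he⟩ := exists_close_of_card_lt F hF hN (by rwa [hJ])
  obtain ⟨x, y, hx, hy, hxy, hfxy⟩ := ha i j hij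
  have hclose : ∀ l < k, ∀ u v, ‖M i l u v - M j l u v‖ ≤ 2 / N := by
    intro l hl u v
    refine (Complex.norm_le_abs_re_add_abs_im _).trans ?_
    have h1 := he (true, ⟨l, hl⟩, u, v)
    have h2 := he (false, ⟨l, hl⟩, u, v)
    simp only [F, if_true, Bool.false_eq_true, if_false] at h1 h2
    rw [Complex.sub_re, Complex.sub_im]
    calc _ ≤ (1 : ℝ) / N + 1 / N := add_le_add h1 h2
      _ = 2 / N := by ring
  have hlayer : ∀ l ≤ k, stateNorm (P.state x (l * n) - P.state y (l * n)) ≤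
      l * (w ^ 2 * (2 / N)) := by
    intro l hl
    induction l with
    | zero => simp [state, stateNorm]
    | succ l ih =>
      have hA := P.stateNorm_sub_le_of_seg_close x y (i := l * n) (m := s) (c := 2 / N)
        (by
          rw [P.seg_congr fun r hr => readBit_congr_prefix hx l hr (by omega),
            P.seg_congr (bits := readBit P.order y) fun r hr =>
              readBit_congr_prefix hy l hr (by omega)]
          exact hclose l hl)
      have hB := P.stateNorm_sub_le_of_seg_close x y (i := l * n + s) (m := n - s) (c := 0)
        (by
          rw [P.seg_congr (bits := readBit P.order x) (bits' := readBit P.order y) fun r hr => ?_]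
          · simp
          · rw [add_assoc]
            exact readBit_congr_suffix hxy l (by omega) (by omega))
      have e : l * n + s + (n - s) = (l + 1) * n := by rw [Nat.succ_mul]; omega
      rw [e] at hB
      have := ih (by omega)
      push_cast
      linarith
  have hgap := (hf.two_mul_le_abs_sub hfxy).trans (P.acceptProb_sub_le x y)
  have h := mul_le_mul_of_nonneg_left (hlayer k le_rfl) (show (0 : ℝ) ≤ 2 * w by positivity)
  have e : (2 * w * (k * (w ^ 2 * (2 / N))) : ℝ) = 4 * k * w ^ 3 / N := by ring
  linarith

end QuantumOBDD

/-! ### Matrix XOR pointer jumping -/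

lemma blockVal_lt (t : ℕ) {n : ℕ} (x : Fin n → Bool) (p : ℕ) : blockVal t x p < 2 ^ t :=
  Nat.ofBits_lt_two_pow _

lemma mxpjVertex_lt (k t : ℕ) {n : ℕ} (x : Fin n → Bool) (j : ℕ) : mxpjVertex k t x j < 2 ^ t := by
  induction j using Nat.twoStepInduction with
  | zero => exact Nat.two_pow_pos t
  | one => exact blockVal_lt _ _ _
  | more j ih _ => exact Nat.xor_lt_two_pow (blockVal_lt _ _ _) ih

/-- The vertex `v_{2 l - 1}`. -/
def mxpjPrev (k t : ℕ) {n : ℕ} (x : Fin n → Bool) : ℕ → ℕ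
  | 0 => 0
  | l + 1 => mxpjVertex k t x (2 * l + 1)

/-- The convention `v_{-1} = 0` gives the first jump the same form as all later ones. -/
lemma mxpjVertex_odd (k t : ℕ) {n : ℕ} (x : Fin n → Bool) (l : ℕ) :
    mxpjVertex k t x (2 * l + 1) =
      mxpjPrev k t x l ^^^ blockVal t x (l * 2 ^ t + mxpjVertex k t x (2 * l)) := by
  rw [Nat.xor_comm]
  cases l with
  | zero => simp [mxpjVertex, mxpjPrev, mxpjTable]
  | succ l =>
    have e : 2 * (l + 1) + 1 = (2 * l + 1) + 2 := by ring
    have h : Even (2 * l + 1 + 1) := ⟨l + 1, by ring⟩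
    have h2 : (2 * l + 1 + 1) / 2 = l + 1 := by omega
    rw [e, mxpjVertex, mxpjTable, if_pos h, h2]
    rfl

lemma mxpjVertex_even_succ (k t : ℕ) {n : ℕ} (x : Fin n → Bool) (l : ℕ) :
    mxpjVertex k t x (2 * l + 2) = mxpjVertex k t x (2 * l) ^^^
      blockVal t x ((k + l) * 2 ^ t + mxpjVertex k t x (2 * l + 1)) := by
  have h : ¬ Even (2 * l + 1) := by simp
  have h2 : (2 * l + 1) / 2 = l := by omega
  rw [Nat.xor_comm, mxpjVertex, mxpjTable, if_neg h, h2]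

/-! #### The program -/

/-- The variable that holds bit `b` of the value at `v` of table `q`. -/
def tablePos (t q v b : ℕ) : ℕ := (q * 2 ^ t + v) * t + b

lemma tablePos_lt {t q q' v b : ℕ} (hq : q < q') (hv : v < 2 ^ t) (hb : b < t) :
    tablePos t q v b < q' * 2 ^ t * t := by
  have h1 : q * 2 ^ t + v + 1 ≤ q' * 2 ^ t :=
    calc q * 2 ^ t + v + 1 ≤ (q + 1) * 2 ^ t := by rw [Nat.succ_mul]; omega
      _ ≤ q' * 2 ^ t := Nat.mul_le_mul_right _ hq
  calc tablePos t q v b < (q * 2 ^ t + v + 1) * t := by rw [tablePos, Nat.succ_mul]; omega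
    _ ≤ q' * 2 ^ t * t := Nat.mul_le_mul_right _ h1

lemma le_tablePos {t q q' v b : ℕ} (hq : q' ≤ q) : q' * 2 ^ t * t ≤ tablePos t q v b :=
  calc q' * 2 ^ t * t ≤ (q * 2 ^ t + v) * t :=
        Nat.mul_le_mul_right _ ((Nat.mul_le_mul_right _ hq).trans (Nat.le_add_right _ _))
    _ ≤ _ := Nat.le_add_right _ _

/-- The bit to be added at the place `b` when variable `i` is tested. -/
def tableMask (t q i : ℕ) (bit : Bool) (v : Fin t → Bool) (b : Fin t) : Bool :=
  decide (tablePos t q (Nat.ofBits v) b = i) && bit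

section XorPerm

variable {t : ℕ}

/-- An involution, because the mask depends only on the component that is left unchanged. -/
def xorFst (c : (Fin t → Bool) → Fin t → Bool) : Equiv.Perm ((Fin t → Bool) × (Fin t → Bool)) :=
  Function.Involutive.toPerm (fun p => (fun b => xor (p.1 b) (c p.2 b), p.2)) fun p => by simp

def xorSnd (c : (Fin t → Bool) → Fin t → Bool) : Equiv.Perm ((Fin t → Bool) × (Fin t → Bool)) :=
  Function.Involutive.toPerm (fun p => (p.1, fun b => xor (p.2 b) (c p.1 b))) fun p => by simp

end XorPerm

/-- In layer `l`, the table `f_{A,l+1}` is applied to the second component and added to the first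
one, then `f_{B,l+1}` is applied to the first component and added to the second one. -/
def mxpjGate (k t n : ℕ) (j : ℕ) (bit : Bool) : Equiv.Perm ((Fin t → Bool) × (Fin t → Bool)) :=
  xorSnd (tableMask t (k + j / n) (j % n) bit) * xorFst (tableMask t (j / n) (j % n) bit)

/-- The part of bit `b` of the value at `v` of table `q` that has been read before step `i`. -/
def tablePart (t : ℕ) {n : ℕ} (x : Fin n → Bool) (q v i b : ℕ) : Bool :=
  decide (tablePos t q v b < i) && if h : tablePos t q v b < n then x ⟨_, h⟩ else false

lemma tablePart_succ (t : ℕ) {n : ℕ} (x : Fin n → Bool) (q v b : ℕ) {i : ℕ} (hi : i < n) :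
    tablePart t x q v (i + 1) b =
      xor (tablePart t x q v i b) (decide (tablePos t q v b = i) && x ⟨i, hi⟩) := by
  unfold tablePart
  rcases lt_trichotomy (tablePos t q v b) i with h | h | h
  · simp [h, h.ne, Nat.lt_succ_of_lt h]
  · subst h
    simp [hi]
  · simp [h.ne', not_lt.2 h.le, not_lt.2 (Nat.succ_le_of_lt h)]

lemma testBit_blockVal (t : ℕ) {n : ℕ} (x : Fin n → Bool) (q v i b : ℕ) (hb : b < t)
    (hi : tablePos t q v b < i) :
    (blockVal t x (q * 2 ^ t + v)).testBit b = tablePart t x q v i b := by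
  rw [blockVal, Nat.testBit_ofBits_lt _ _ hb]
  simp [tablePart, hi]
  rfl

lemma ofBits_eq_of_testBit {t m : ℕ} (hm : m < 2 ^ t) {g : Fin t → Bool}
    (h : ∀ b, g b = m.testBit b) : Nat.ofBits g = m := by
  rw [show g = fun b : Fin t => m.testBit b from funext h, Nat.ofBits_testBit,
    Nat.mod_eq_of_lt hm]

section MxpjProgram

variable {k t n : ℕ} (x : Fin n → Bool)

/-- All tables of the first half are read before those of the second half. While table `l` is read,
the second component is still `v_{2l}`; when table `k + l` is read, the first one has already become
`v_{2l+1}`. So every lookup uses the right vertex, although its bits are added one at a time. -/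
lemma permRun_mxpj_within_layer {l : ℕ} (hl : l < k)
    (h0 : permRun (mxpjGate k t n) (fun _ => false, fun _ => false) x (l * n) =
      (fun b : Fin t => (mxpjPrev k t x l).testBit b,
        fun b : Fin t => (mxpjVertex k t x (2 * l)).testBit b))
    {i : ℕ} (hi : i ≤ n) :
    permRun (mxpjGate k t n) (fun _ => false, fun _ => false) x (l * n + i) =
      (fun b : Fin t => xor ((mxpjPrev k t x l).testBit b)
          (tablePart t x l (mxpjVertex k t x (2 * l)) i b),
        fun b : Fin t => xor ((mxpjVertex k t x (2 * l)).testBit b)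
          (tablePart t x (k + l) (mxpjVertex k t x (2 * l + 1)) i b)) := by
  induction i with
  | zero => simpa [tablePart] using h0
  | succ i ih =>
    have hin : i < n := hi
    have hdiv : (l * n + i) / n = l := by
      rw [add_comm, Nat.add_mul_div_right _ _ (by omega), Nat.div_eq_of_lt hin, zero_add]
    have hmod : (l * n + i) % n = i := by
      rw [add_comm, Nat.add_mul_mod_self_right, Nat.mod_eq_of_lt hin]
    rw [← add_assoc, permRun, ih (by omega), readBit_layer 1 x l hin]
    simp only [mxpjGate, hdiv, hmod, Equiv.Perm.coe_mul, Function.comp_apply, xorFst, xorSnd,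
      Function.Involutive.coe_toPerm, Equiv.Perm.coe_one, id]
    have hfst : ∀ b : Fin t,
        xor (xor ((mxpjPrev k t x l).testBit b) (tablePart t x l (mxpjVertex k t x (2 * l)) i b))
          (tableMask t l i (x ⟨i, hin⟩) (fun b => xor ((mxpjVertex k t x (2 * l)).testBit b)
            (tablePart t x (k + l) (mxpjVertex k t x (2 * l + 1)) i b)) b) =
        xor ((mxpjPrev k t x l).testBit b)
          (tablePart t x l (mxpjVertex k t x (2 * l)) (i + 1) b) := by
      intro b
      rw [tablePart_succ _ _ _ _ _ hin, Bool.xor_assoc]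
      congr 2
      unfold tableMask
      congr 1
      rcases lt_or_ge i (k * 2 ^ t * t) with h | h
      · rw [ofBits_eq_of_testBit (mxpjVertex_lt k t x (2 * l))]
        intro b
        simp [tablePart, not_lt.2 (h.le.trans (le_tablePos (Nat.le_add_right k l)))]
      · have h1 := tablePos_lt hl (Nat.ofBits_lt_two_pow fun b : Fin t =>
          xor ((mxpjVertex k t x (2 * l)).testBit b)
            (tablePart t x (k + l) (mxpjVertex k t x (2 * l + 1)) i b)) b.2
        have h2 := tablePos_lt hl (mxpjVertex_lt k t x (2 * l)) b.2
        rw [decide_eq_false (by omega), decide_eq_false (by omega)]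
    simp only [hfst]
    refine Prod.ext rfl (funext fun b => ?_)
    dsimp only
    rw [tablePart_succ _ _ _ _ _ hin, Bool.xor_assoc]
    congr 2
    unfold tableMask
    congr 1
    rcases lt_or_ge i (k * 2 ^ t * t) with h | h
    · rw [decide_eq_false, decide_eq_false]
      · exact (h.trans_le (le_tablePos (Nat.le_add_right k l))).ne'
      · exact (h.trans_le (le_tablePos (Nat.le_add_right k l))).ne'
    · rw [ofBits_eq_of_testBit (mxpjVertex_lt k t x (2 * l + 1))]
      intro b
      have h2 := tablePos_lt hl (mxpjVertex_lt k t x (2 * l)) b.2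
      rw [mxpjVertex_odd, Nat.testBit_xor, testBit_blockVal t x l _ (i + 1) b b.2 (by omega)]

lemma permRun_mxpj (hn : 2 * k * 2 ^ t * t ≤ n) {l : ℕ} (hl : l ≤ k) :
    permRun (mxpjGate k t n) (fun _ => false, fun _ => false) x (l * n) =
      (fun b : Fin t => (mxpjPrev k t x l).testBit b,
        fun b : Fin t => (mxpjVertex k t x (2 * l)).testBit b) := by
  induction l with
  | zero => simp [permRun, mxpjPrev, mxpjVertex]
  | succ l ih =>
    rw [Nat.succ_mul, permRun_mxpj_within_layer x hl (ih (by omega)) le_rfl]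
    refine Prod.ext (funext fun b => ?_) (funext fun b => ?_)
    · dsimp only
      have h := tablePos_lt (show l < 2 * k by omega) (mxpjVertex_lt k t x (2 * l)) b.2
      rw [mxpjPrev, mxpjVertex_odd, Nat.testBit_xor, testBit_blockVal t x l _ n b b.2 (by omega)]
    · dsimp only
      have h := tablePos_lt (show k + l < 2 * k by omega) (mxpjVertex_lt k t x (2 * l + 1)) b.2
      rw [show 2 * (l + 1) = 2 * l + 2 by ring, mxpjVertex_even_succ, Nat.testBit_xor,
        testBit_blockVal t x (k + l) _ n b b.2 (by omega)]

end MxpjProgram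

/-- The upper bounds for matrix XOR pointer jumping. -/
theorem mxpj_mem_classes {k t n : ℕ} (hn : 2 * k * 2 ^ t * t ≤ n) {W : ℝ}
    (hW : ((2 ^ t : ℕ) : ℝ) ^ 2 ≤ W) :
    mxpj k t n ∈ classIdOBDD k n W ∧ mxpj k t n ∈ classIdNOBDD k n W ∧
      ∀ ε : ℝ, 0 < ε → ε ≤ 1 / 2 →
        mxpj k t n ∈ classIdPOBDD k n ε W ∧ mxpj k t n ∈ classIdQOBDD k n ε W := by
  refine mem_classes_of_permRun (mxpjGate k t n) (fun _ => false, fun _ => false)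
    {p | Odd #{b ∈ range t | ∃ h : b < t, p.2 ⟨b, h⟩ = true}} (fun x => ?_) (le_trans ?_ hW)
  · rw [permRun_mxpj x hn le_rfl]
    have e : {b ∈ range t | (mxpjVertex k t x (2 * k)).testBit b} =
        {b ∈ range t | ∃ _ : b < t, (mxpjVertex k t x (2 * k)).testBit b = true} := by
      refine filter_congr fun b hb => ?_
      simp [mem_range.1 hb]
    simp [mxpj, e]
  · simp [sq]

/-! #### Rows of matrix XOR pointer jumping -/

/-- The input with the tables `α 0, …, α (k - 1), β 0, …, β (k - 1)`. -/
def tableInput (k t n : ℕ) (α β : ℕ → ℕ → ℕ) : Fin n → Bool := fun i =>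
  (if (i : ℕ) / t / 2 ^ t < k then α (i / t / 2 ^ t) (i / t % 2 ^ t)
    else β (i / t / 2 ^ t - k) (i / t % 2 ^ t)).testBit (i % t)

section TableInput

variable {k t n : ℕ} {α β : ℕ → ℕ → ℕ}

lemma blockVal_tableInput (hn : 2 * k * 2 ^ t * t ≤ n) (hα : ∀ q v, α q v < 2 ^ t)
    (hβ : ∀ q v, β q v < 2 ^ t) {q v : ℕ} (hq : q < 2 * k) (hv : v < 2 ^ t) :
    blockVal t (tableInput k t n α β) (q * 2 ^ t + v) =
      if q < k then α q v else β (q - k) v := by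
  refine ofBits_eq_of_testBit (by split_ifs <;> [exact hα q v; exact hβ _ v]) fun b => ?_
  have hlt := tablePos_lt hq hv b.2
  rw [tablePos] at hlt
  have h1 : ((q * 2 ^ t + v) * t + b) / t = q * 2 ^ t + v := by
    rw [add_comm, Nat.add_mul_div_right _ _ b.pos, Nat.div_eq_of_lt b.2, zero_add]
  have h2 : ((q * 2 ^ t + v) * t + b) % t = b := by
    rw [add_comm, Nat.add_mul_mod_self_right, Nat.mod_eq_of_lt b.2]
  have h3 : (q * 2 ^ t + v) / 2 ^ t = q := by
    rw [add_comm, Nat.add_mul_div_right _ _ (Nat.two_pow_pos t), Nat.div_eq_of_lt hv, zero_add]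
  have h4 : (q * 2 ^ t + v) % 2 ^ t = v := by
    rw [add_comm, Nat.add_mul_mod_self_right, Nat.mod_eq_of_lt hv]
  rw [dif_pos (hlt.trans_le hn)]
  simp only [tableInput, h1, h2, h3, h4]

lemma mxpjVertex_tableInput_odd (hn : 2 * k * 2 ^ t * t ≤ n) (hα : ∀ q v, α q v < 2 ^ t)
    (hβ : ∀ q v, β q v < 2 ^ t) {l : ℕ} (hl : l < k) :
    mxpjVertex k t (tableInput k t n α β) (2 * l + 1) =
      mxpjPrev k t (tableInput k t n α β) l ^^^
        α l (mxpjVertex k t (tableInput k t n α β) (2 * l)) := by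
  rw [mxpjVertex_odd, blockVal_tableInput hn hα hβ (by omega) (mxpjVertex_lt _ _ _ _), if_pos hl]

lemma mxpjVertex_tableInput_even_succ (hn : 2 * k * 2 ^ t * t ≤ n) (hα : ∀ q v, α q v < 2 ^ t)
    (hβ : ∀ q v, β q v < 2 ^ t) {l : ℕ} (hl : l < k) :
    mxpjVertex k t (tableInput k t n α β) (2 * l + 2) =
      mxpjVertex k t (tableInput k t n α β) (2 * l) ^^^
        β l (mxpjVertex k t (tableInput k t n α β) (2 * l + 1)) := by
  rw [mxpjVertex_even_succ, blockVal_tableInput hn hα hβ (by omega) (mxpjVertex_lt _ _ _ _),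
    if_neg (by omega), Nat.add_sub_cancel_left]

lemma mem_prefixSet_one {n s : ℕ} {v : Fin n} : v ∈ prefixSet 1 s ↔ (v : ℕ) < s := Iff.rfl

lemma tableInput_congr_left {β' : ℕ → ℕ → ℕ} :
    ∀ v ∈ prefixSet (1 : Equiv.Perm (Fin n)) (k * 2 ^ t * t),
      tableInput k t n α β v = tableInput k t n α β' v := by
  intro v hv
  rw [mem_prefixSet_one] at hv
  have ht : 0 < t := Nat.pos_of_ne_zero fun h => by simp [h] at hv
  have h : (v : ℕ) / t / 2 ^ t < k := by
    rw [Nat.div_lt_iff_lt_mul (Nat.two_pow_pos t), Nat.div_lt_iff_lt_mul ht]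
    exact hv
  simp only [tableInput, if_pos h]

lemma tableInput_congr_right {α' : ℕ → ℕ → ℕ} (ht : 0 < t) :
    ∀ v ∉ prefixSet (1 : Equiv.Perm (Fin n)) (k * 2 ^ t * t),
      tableInput k t n α β v = tableInput k t n α' β v := by
  intro v hv
  rw [mem_prefixSet_one, not_lt] at hv
  have h : ¬ (v : ℕ) / t / 2 ^ t < k := by
    rw [Nat.div_lt_iff_lt_mul (Nat.two_pow_pos t), Nat.div_lt_iff_lt_mul ht]
    exact not_lt.2 hv
  simp only [tableInput, if_neg h]

end TableInput

/-- The tables of the second half that make the value of the function tell whether entry `p` of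
table `l₀` of the first half is `s`. -/
def queryTable (k l₀ p s : ℕ) (l z : ℕ) : ℕ :=
  (if l + 1 = l₀ then p else 0) ^^^ (if l = l₀ then p else 0) ^^^
    (if l + 1 = k ∧ z = s then 1 else 0)

lemma queryTable_lt {k t l₀ p s : ℕ} (ht : 0 < t) (hp : p < 2 ^ t) (l z : ℕ) :
    queryTable k l₀ p s l z < 2 ^ t := by
  have h0 := Nat.two_pow_pos t
  have h1 : 1 < 2 ^ t := Nat.one_lt_two_pow ht.ne'
  unfold queryTable
  refine Nat.xor_lt_two_pow (Nat.xor_lt_two_pow ?_ ?_) ?_ <;> split_ifs <;> assumption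

/-- Up to the final test, the tables of the second half are constant: one constant `p` brings the
even vertex from `0` to `p` just before layer `l₀`, the next one brings it back. In all other layers
the even vertex is `0`, where the first half's tables vanish, so the odd vertex picks up `α l₀ p` in
layer `l₀` and keeps it. Table `0` is consulted only at vertex `0`, hence `0 < l₀`. -/
lemma mxpjVertex_query {k t n : ℕ} {α : ℕ → ℕ → ℕ} (ht : 0 < t) (hn : 2 * k * 2 ^ t * t ≤ n)
    (hα : ∀ q v, α q v < 2 ^ t) (hα0 : ∀ q, α q 0 = 0) {l₀ p : ℕ} (s : ℕ) (hl₀ : 0 < l₀)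
    (hl₀k : l₀ < k) (hp : p < 2 ^ t) {l : ℕ} (hl : l < k) :
    mxpjVertex k t (tableInput k t n α (queryTable k l₀ p s)) (2 * l) = (if l = l₀ then p else 0) ∧
    mxpjVertex k t (tableInput k t n α (queryTable k l₀ p s)) (2 * l + 1) =
      if l < l₀ then 0 else α l₀ p := by
  have hβ := queryTable_lt (k := k) (l₀ := l₀) (s := s) ht hp
  induction l with
  | zero =>
    rw [mxpjVertex_tableInput_odd hn hα hβ hl, if_neg hl₀.ne, if_pos hl₀]
    simp [mxpjVertex, mxpjPrev, hα0]
  | succ l ih =>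
    obtain ⟨h1, h2⟩ := ih (by omega)
    have h3 : mxpjVertex k t (tableInput k t n α (queryTable k l₀ p s)) (2 * (l + 1)) =
        if l + 1 = l₀ then p else 0 := by
      rw [show 2 * (l + 1) = 2 * l + 2 by ring,
        mxpjVertex_tableInput_even_succ hn hα hβ (by omega), h1, queryTable,
        if_neg (show ¬ (l + 1 = k ∧ _) by omega), Nat.xor_zero, Nat.xor_comm, Nat.xor_assoc,
        Nat.xor_self, Nat.xor_zero]
    refine ⟨h3, ?_⟩
    rw [mxpjVertex_tableInput_odd hn hα hβ hl, h3, mxpjPrev, h2]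
    rcases lt_trichotomy (l + 1) l₀ with h | h | h
    · simp [h.ne, h, hα0, show l < l₀ by omega]
    · subst h
      simp
    · simp [h.ne', hα0, show ¬ l < l₀ by omega, show ¬ l + 1 < l₀ by omega]

/-- The last table sees the stored entry as its argument and adds `1` exactly if it equals `s`; by
then the even vertex has been cleared, so `v_{2k}` is `0` or `1`. -/
lemma mxpj_query {k t n : ℕ} {α : ℕ → ℕ → ℕ} (ht : 0 < t) (hn : 2 * k * 2 ^ t * t ≤ n)
    (hα : ∀ q v, α q v < 2 ^ t) (hα0 : ∀ q, α q 0 = 0) {l₀ p : ℕ} (s : ℕ) (hl₀ : 0 < l₀)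
    (hl₀k : l₀ < k) (hp : p < 2 ^ t) :
    mxpj k t n (tableInput k t n α (queryTable k l₀ p s)) = decide (α l₀ p = s) := by
  have hβ := queryTable_lt (k := k) (l₀ := l₀) (s := s) ht hp
  obtain ⟨l, rfl⟩ : ∃ l, k = l + 1 := ⟨k - 1, by omega⟩
  obtain ⟨h1, h2⟩ := mxpjVertex_query ht hn hα hα0 s hl₀ hl₀k hp (show l < l + 1 by omega)
  have h3 : mxpjVertex (l + 1) t (tableInput (l + 1) t n α (queryTable (l + 1) l₀ p s))
      (2 * (l + 1)) = if α l₀ p = s then 1 else 0 := by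
    rw [show 2 * (l + 1) = 2 * l + 2 by ring,
      mxpjVertex_tableInput_even_succ hn hα hβ (by omega), h1, h2, queryTable, if_neg hl₀k.ne',
      if_neg (show ¬ l < l₀ by omega), Nat.zero_xor, ← Nat.xor_assoc, Nat.xor_self, Nat.zero_xor]
    simp
  rw [mxpj, h3]
  congr 1
  by_cases h : α l₀ p = s
  · have : {b ∈ range t | Nat.testBit 1 b} = {0} := by
      ext b
      simp only [mem_filter, mem_range, mem_singleton, Nat.testBit_one_eq_true_iff_self_eq_zero]
      omega
    simp [h, this]
  · simp [h]

/-- Tables of the first half: table `0` and the entries at `0` vanish. -/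
def freeTable (k t : ℕ) (c : Fin (k - 1) → Fin (2 ^ t - 1) → Fin (2 ^ t)) (l v : ℕ) : ℕ :=
  if h : (0 < l ∧ l < k) ∧ 0 < v ∧ v < 2 ^ t then c ⟨l - 1, by omega⟩ ⟨v - 1, by omega⟩ else 0

lemma freeTable_lt {k t : ℕ} (c : Fin (k - 1) → Fin (2 ^ t - 1) → Fin (2 ^ t)) (l v : ℕ) :
    freeTable k t c l v < 2 ^ t := by
  unfold freeTable
  split_ifs
  · exact Fin.is_lt _
  · exact Nat.two_pow_pos t

/-- Where `c` and `c'` differ, ask whether the entry is the one of `c'`. -/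
lemma mxpj_rowsSeparated {k t n : ℕ} (ht : 0 < t) (hn : 2 * k * 2 ^ t * t ≤ n) :
    RowsSeparated (mxpj k t n) (prefixSet 1 (k * 2 ^ t * t))
      (fun c : Fin (k - 1) → Fin (2 ^ t - 1) → Fin (2 ^ t) =>
        tableInput k t n (freeTable k t c) 0) := by
  intro c c' hne
  obtain ⟨l, hl⟩ := Function.ne_iff.1 hne
  obtain ⟨v, hv⟩ := Function.ne_iff.1 hl
  have hval : ∀ c : Fin (k - 1) → Fin (2 ^ t - 1) → Fin (2 ^ t),
      freeTable k t c (l + 1) (v + 1) = c l v := by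
    intro c
    rw [freeTable, dif_pos (by omega)]
    rfl
  have hz : ∀ (c : Fin (k - 1) → Fin (2 ^ t - 1) → Fin (2 ^ t)) q, freeTable k t c q 0 = 0 := by
    intro c q
    simp [freeTable]
  have hq : ∀ c, mxpj k t n (tableInput k t n (freeTable k t c)
      (queryTable k (l + 1) (v + 1) (c' l v))) = decide ((c l v : ℕ) = c' l v) := by
    intro c
    rw [mxpj_query ht hn (freeTable_lt c) (hz c) _ (by omega) (by omega) (by omega), hval]
  refine ⟨_, _, tableInput_congr_left (β := queryTable k (l + 1) (v + 1) (c' l v)),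
    tableInput_congr_left, tableInput_congr_right ht, ?_⟩
  rw [hq c, hq c', decide_eq_true (rfl : (c' l v : ℕ) = c' l v)]
  simpa [Fin.ext_iff] using hv

/-! ### A function that is hard for every order

In every layer, the variables are read in slots.  A slot belonging to a label consists of one
variable that carries a bit of information and of variables that control the transposition which
this bit performs, and the layer in which it is performed. -/

section Sequences

variable {σ : Type*} {z : ℕ → σ} {h : ℕ → σ → σ} {a b : ℕ}

lemma seq_const (hab : a ≤ b) (hz : ∀ g, a ≤ g → g < b → z (g + 1) = h g (z g))
    (hfix : ∀ g, a ≤ g → g < b → h g (z a) = z a) : z b = z a := by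
  induction b, hab using Nat.le_induction with
  | base => rfl
  | succ b hb ih =>
    rw [hz b hb (by omega), ih (fun g h1 h2 => hz g h1 (by omega))
      (fun g h1 h2 => hfix g h1 (by omega)), hfix b hb (by omega)]

/-- Trajectories through a layer are followed with this lemma and `seq_const`: the state at hand is
fixed by all steps but one. -/
lemma seq_move {g₀ : ℕ} {q' : σ} (hz : ∀ g, a ≤ g → g < b → z (g + 1) = h g (z g)) (ha : a ≤ g₀)
    (hb : g₀ < b) (h₁ : ∀ g, a ≤ g → g < g₀ → h g (z a) = z a) (h₂ : h g₀ (z a) = q')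
    (h₃ : ∀ g, g₀ < g → g < b → h g q' = q') : z b = q' := by
  have e₁ : z g₀ = z a := seq_const ha (fun g h1 h2 => hz g h1 (by omega)) h₁
  have e₂ : z (g₀ + 1) = q' := by rw [hz g₀ ha hb, e₁, h₂]
  rw [← e₂]
  refine seq_const (Nat.succ_le_of_lt hb) (fun g h1 h2 => hz g (by omega) h2) fun g h1 h2 => ?_
  rw [e₂, h₃ g (by omega) h2]

end Sequences

/-! ### Slots: one fixed transposition conjugated by control bits -/

section Slots

variable {σ Λ : Type*} [Fintype Λ] [DecidableEq Λ] (lay : Λ → ℕ) (ctl : Λ → Equiv.Perm σ)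
  (core : Equiv.Perm σ)

/-- The control of the label `c`, which is active in one layer only. -/
def onLayer (l : ℕ) (c : Λ) : Equiv.Perm σ := if lay c = l then ctl c else 1

/-- The permutation applied in layer `l` at the offset `r` of a slot. -/
noncomputable def slotGate (l r : ℕ) (bit : Bool) : Equiv.Perm σ :=
  if bit then
    if h : r < Fintype.card Λ then onLayer lay ctl l ((Fintype.equivFin Λ).symm ⟨r, h⟩)
    else if r = Fintype.card Λ then core
    else if h : r - (Fintype.card Λ + 1) < Fintype.card Λ then
      (onLayer lay ctl l ((Fintype.equivFin Λ).symm ⟨r - (Fintype.card Λ + 1), h⟩))⁻¹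
    else 1
  else 1

/-- The bits of a slot which is used for the label `o` and carries the bit `y o`. -/
noncomputable def slotBit (y : Λ → Bool) (o : Option Λ) (r : ℕ) : Bool :=
  if h : r < Fintype.card Λ then decide (o = some ((Fintype.equivFin Λ).symm ⟨r, h⟩))
  else if r = Fintype.card Λ then o.elim false y
  else if h : r - (Fintype.card Λ + 1) < Fintype.card Λ then
    decide (o = some ((Fintype.equivFin Λ).symm ⟨r - (Fintype.card Λ + 1), h⟩))
  else false

/-- The effect in layer `l` of a slot used for the label `o`. -/
def slotOp (y : Λ → Bool) (l : ℕ) (o : Option Λ) : Equiv.Perm σ :=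
  o.elim 1 fun c =>
    (onLayer lay ctl l c)⁻¹ * (if y c then core else 1) * onLayer lay ctl l c

variable {lay ctl core}

lemma slotBit_none (y : Λ → Bool) (r : ℕ) : slotBit y none r = false := by
  simp [slotBit]

/-- The control bits switch on a single control before the core and its inverse after it, so the
slot applies a conjugate of the core, or the identity if its information bit is `false`. -/
lemma seq_slot {y : Λ → Bool} {o : Option Λ} {l : ℕ} {z : ℕ → σ}
    (hz : ∀ r < 2 * Fintype.card Λ + 1,
      z (r + 1) = slotGate lay ctl core l r (slotBit y o r) (z r)) :
    z (2 * Fintype.card Λ + 1) = slotOp lay ctl core y l o (z 0) := by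
  set K := Fintype.card Λ with hK
  set e := Fintype.equivFin Λ with he
  cases o with
  | none =>
    refine seq_const (h := fun r => slotGate lay ctl core l r (slotBit y none r)) (Nat.zero_le _)
      (fun g _ hg => hz g hg) fun g _ _ => ?_
    simp [slotBit_none, slotGate]
  | some c =>
    have hne : ∀ r (h : r < K), r ≠ e c → c ≠ e.symm ⟨r, h⟩ := by
      rintro r h hr rfl
      simp at hr
    have hec : (e c : ℕ) < K := (e c).2
    have e₁ : z K = onLayer lay ctl l c (z 0) := by
      refine seq_move (h := fun r => slotGate lay ctl core l r (slotBit y (some c) r))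
        (g₀ := e c) (fun g _ hg => hz g (by omega)) (Nat.zero_le _) (e c).2
        (fun g _ hg => ?_) ?_ (fun g hg hgK => ?_)
      · have hgK : g < K := by omega
        have := hne g hgK hg.ne
        simp [slotBit, slotGate, hgK, ← hK, ← he, this]
      · simp [slotBit, slotGate, ← hK, ← he, hec]
      · have := hne g hgK hg.ne'
        simp [slotBit, slotGate, hgK, ← hK, ← he, this]
    have e₂ : z (K + 1) = (if y c then core else 1 : Equiv.Perm σ) (z K) := by
      rw [hz K (by omega)]
      simp [slotBit, slotGate, ← hK]
    have e₃ : z (K + 1 + K) = (onLayer lay ctl l c)⁻¹ (z (K + 1)) := by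
      have hlt : ∀ g, K + 1 ≤ g → ¬ g < K := fun g h1 => by omega
      have hneq : ∀ g, K + 1 ≤ g → ¬ g = K := fun g h1 => by omega
      refine seq_move (h := fun r => slotGate lay ctl core l r (slotBit y (some c) r))
        (a := K + 1) (g₀ := K + 1 + e c) (fun g _ hg => hz g (by omega)) (by omega) (by omega)
        (fun g hg hg' => ?_) ?_ (fun g hg hgK => ?_)
      · have hgK : g - (K + 1) < K := by omega
        have := hne _ hgK (by omega)
        simp [slotBit, slotGate, hlt g hg, hneq g hg, hgK, ← hK, ← he, this]
      · have h1 := hlt (K + 1 + e c) (by omega)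
        have h2 := hneq (K + 1 + e c) (by omega)
        simp [slotBit, slotGate, ← hK, ← he, h1, h2, hec]
      · have hgK : g - (K + 1) < K := by omega
        have := hne _ hgK (by omega)
        simp [slotBit, slotGate, hlt g (by omega), hneq g (by omega), hgK, ← hK, ← he, this]
    rw [show 2 * K + 1 = K + 1 + K by ring, e₃, e₂, e₁]
    cases hy : y c <;> simp [slotOp, hy]

variable (lay ctl core)

/-- The permutations of the program that consists of slots. -/
noncomputable def slotProgram (n j : ℕ) (bit : Bool) : Equiv.Perm σ :=
  slotGate lay ctl core (j / n) (j % n % (2 * Fintype.card Λ + 1)) bit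

/-- The input whose slot `g` is used for the label `lab g`. -/
noncomputable def slotInput (n : ℕ) (lab : ℕ → Option Λ) (y : Λ → Bool) : Fin n → Bool := fun i =>
  slotBit y (lab (i / (2 * Fintype.card Λ + 1))) (i % (2 * Fintype.card Λ + 1))

variable {lay ctl core}

lemma permRun_slotProgram_succ {n : ℕ} (lab : ℕ → Option Λ) (y : Λ → Bool) (q : σ) (l : ℕ)
    {i : ℕ} (hi : i < n) :
    permRun (slotProgram lay ctl core n) q (slotInput n lab y) (l * n + i + 1) =
      slotGate lay ctl core l (i % (2 * Fintype.card Λ + 1))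
        (slotBit y (lab (i / (2 * Fintype.card Λ + 1))) (i % (2 * Fintype.card Λ + 1)))
        (permRun (slotProgram lay ctl core n) q (slotInput n lab y) (l * n + i)) := by
  have hdiv : (l * n + i) / n = l := by
    rw [add_comm, Nat.add_mul_div_right _ _ (by omega), Nat.div_eq_of_lt hi, zero_add]
  have hmod : (l * n + i) % n = i := by
    rw [add_comm, Nat.add_mul_mod_self_right, Nat.mod_eq_of_lt hi]
  rw [permRun, readBit_layer 1 _ l hi, slotProgram, hdiv, hmod]
  rfl

lemma permRun_slotProgram_slot {n G : ℕ} (hG : G * (2 * Fintype.card Λ + 1) ≤ n)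
    (lab : ℕ → Option Λ) (y : Λ → Bool) (q : σ) (l : ℕ) {g : ℕ} (hg : g < G) :
    permRun (slotProgram lay ctl core n) q (slotInput n lab y)
        (l * n + (g + 1) * (2 * Fintype.card Λ + 1)) =
      slotOp lay ctl core y l (lab g) (permRun (slotProgram lay ctl core n) q (slotInput n lab y)
        (l * n + g * (2 * Fintype.card Λ + 1))) := by
  have hle : (g + 1) * (2 * Fintype.card Λ + 1) ≤ n := (Nat.mul_le_mul_right _ hg).trans hG
  set K := 2 * Fintype.card Λ + 1 with hK
  rw [Nat.succ_mul] at hle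
  have h := seq_slot (lay := lay) (ctl := ctl) (core := core) (y := y) (o := lab g) (l := l)
    (z := fun r => permRun (slotProgram lay ctl core n) q (slotInput n lab y) (l * n + (g * K + r)))
    (fun r hr => by
      have h1 : (g * K + r) / K = g := by
        rw [add_comm, Nat.add_mul_div_right _ _ (by omega), Nat.div_eq_of_lt hr, zero_add]
      have h2 : (g * K + r) % K = r := by
        rw [add_comm, Nat.add_mul_mod_self_right, Nat.mod_eq_of_lt hr]
      have := permRun_slotProgram_succ (lay := lay) (ctl := ctl) (core := core) lab y q l
        (i := g * K + r) (n := n) (by omega)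
      rw [← hK, h1, h2] at this
      exact this)
  rw [Nat.succ_mul]
  exact h

lemma permRun_slotProgram_layer {n G : ℕ} (hG : G * (2 * Fintype.card Λ + 1) ≤ n)
    {lab : ℕ → Option Λ} (hlab : ∀ g, G ≤ g → lab g = none) (y : Λ → Bool) (q : σ) (l : ℕ) :
    permRun (slotProgram lay ctl core n) q (slotInput n lab y) ((l + 1) * n) =
      permRun (slotProgram lay ctl core n) q (slotInput n lab y)
        (l * n + G * (2 * Fintype.card Λ + 1)) := by
  rw [Nat.succ_mul]
  refine seq_const
    (z := fun i => permRun (slotProgram lay ctl core n) q (slotInput n lab y) (l * n + i))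
    (h := fun i => slotGate lay ctl core l (i % (2 * Fintype.card Λ + 1))
        (slotBit y (lab (i / (2 * Fintype.card Λ + 1))) (i % (2 * Fintype.card Λ + 1)))) hG
    (fun i _ hi => permRun_slotProgram_succ lab y q l hi) fun i hi _ => ?_
  rw [hlab _ ((Nat.le_div_iff_mul_le (by omega)).2 hi)]
  simp [slotBit_none, slotGate]

/-- Only the variable at offset `Fintype.card Λ` of a slot carries information; the control bits
depend on the labelling alone and are common to all rows. -/
lemma slotInput_congr {n : ℕ} {lab : ℕ → Option Λ} {y y' : Λ → Bool} {v : Fin n}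
    (h : ∀ c, lab (v / (2 * Fintype.card Λ + 1)) = some c →
      v % (2 * Fintype.card Λ + 1) = Fintype.card Λ → y c = y' c) :
    slotInput n lab y v = slotInput n lab y' v := by
  unfold slotInput slotBit
  split_ifs with h1 h2 <;> try rfl
  cases ho : lab (v / (2 * Fintype.card Λ + 1)) with
  | none => rfl
  | some c => exact h c ho h2

end Slots

/-- A permutation that maps `s` to `a` and `s'` to `b`, if `s ≠ s'` and `a ≠ b`. -/
def steer {σ : Type*} [DecidableEq σ] (a b s s' : σ) : Equiv.Perm σ :=
  Equiv.swap (Equiv.swap s a s') b * Equiv.swap s a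

/-- Conjugating a transposition relabels the two points it exchanges. -/
lemma steer_conj {σ : Type*} [DecidableEq σ] {a b s s' : σ} (hab : a ≠ b) (hs : s ≠ s') :
    (steer a b s s')⁻¹ * Equiv.swap a b * steer a b s s' = Equiv.swap s s' := by
  have h1 : steer a b s s' s = a := by
    have : a ≠ Equiv.swap s a s' := by
      intro h
      rw [eq_comm, Equiv.swap_apply_eq_iff, Equiv.swap_apply_right] at h
      exact hs h.symm
    simp [steer, Equiv.swap_apply_of_ne_of_ne this hab]
  have h2 : steer a b s s' s' = b := by simp [steer]
  have h := Equiv.swap_apply_apply (steer a b s s') s s'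
  rw [h1, h2] at h
  rw [h]
  group

/-! ### The universal function: one-bit cells and queries -/

section Universal

/-- The states: cells with one bit, and four further states `0, 1, 2, 3` (idle, accepting, and two
states that are not reached). -/
abbrev CellState (C : ℕ) := (Fin C × Bool) ⊕ Fin 4

/-- The labels: a bit for the cell `c` in layer `l + 1`, or a bit that moves to or from the value
`b` of cell `c` in layer `l`. -/
abbrev CellLabel (k C : ℕ) := (Fin (k - 1) × Fin C) ⊕ (Fin k × Fin C × Bool)

variable {k C : ℕ}

def labelLayer : CellLabel k C → ℕ
  | .inl p => p.1 + 1
  | .inr p => p.1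

def labelFst : CellLabel k C → CellState C
  | .inl p => .inl (p.2, false)
  | .inr p => .inr (if p.2.2 then 1 else 0)

def labelSnd : CellLabel k C → CellState C
  | .inl p => .inl (p.2, true)
  | .inr p => .inl (p.2.1, p.2.2)

def labelSteer (c : CellLabel k C) : Equiv.Perm (CellState C) :=
  steer (.inr 2) (.inr 3) (labelFst c) (labelSnd c)

lemma labelFst_ne_labelSnd (c : CellLabel k C) : labelFst c ≠ labelSnd c := by
  cases c <;> simp [labelFst, labelSnd]

/-- The permutations of the universal program. -/
noncomputable def cellProgram (k C n : ℕ) : ℕ → Bool → Equiv.Perm (CellState C) :=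
  slotProgram (labelLayer (k := k) (C := C)) labelSteer (Equiv.swap (.inr 2) (.inr 3)) n

/-- The function computed by the universal program. -/
noncomputable def cellFunction (k C n : ℕ) (x : Fin n → Bool) : Bool :=
  decide (permRun (cellProgram k C n) (.inr 0) x (k * n) = .inr 1)

theorem cellFunction_mem_classes (k C n : ℕ) {W : ℝ} (hW : ((2 * C + 4 : ℕ) : ℝ) ≤ W) :
    cellFunction k C n ∈ classIdOBDD k n W ∧ cellFunction k C n ∈ classIdNOBDD k n W ∧
      ∀ ε : ℝ, 0 < ε → ε ≤ 1 / 2 →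
        cellFunction k C n ∈ classIdPOBDD k n ε W ∧ cellFunction k C n ∈ classIdQOBDD k n ε W := by
  refine mem_classes_of_permRun (cellProgram k C n) (.inr 0) {.inr 1} (fun x => ?_) (le_trans ?_ hW)
  · simp [cellFunction]
  · simp [mul_comm]

/-- The bits of the labels: the contents `α` of the cells, and the query for cell `c₀` in
layer `l₀ + 1`. -/
def cellBits (α : Fin (k - 1) → Fin C → Bool) (query : Fin k × Fin C × Bool → Bool) :
    CellLabel k C → Bool
  | .inl p => α p.1 p.2
  | .inr p => query p

/-- In layer `l₀` only the transposition into the value `false` is active: it takes the idle state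
into cell `c₀`. In layer `l₀ + 1` both values are let out, `true` to the accepting state and `false`
back to the idle one. -/
def cellQuery (l₀ : Fin (k - 1)) (c₀ : Fin C) (p : Fin k × Fin C × Bool) : Bool :=
  decide (p.2.1 = c₀ ∧ (((p.1 : ℕ) = l₀ ∧ p.2.2 = false) ∨ (p.1 : ℕ) = l₀ + 1))

/-- Slots are assigned to the labels by `φ`. -/
noncomputable def slotLabel (φ : CellLabel k C → ℕ) (g : ℕ) : Option (CellLabel k C) :=
  Function.partialInv φ g

section Query

variable {φ : CellLabel k C → ℕ} (hφ : Function.Injective φ)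

include hφ

lemma slotLabel_apply (c : CellLabel k C) : slotLabel φ (φ c) = some c :=
  Function.partialInv_left hφ c

lemma slotLabel_eq_some {g : ℕ} {c : CellLabel k C} : slotLabel φ g = some c ↔ φ c = g :=
  hφ.isPartialInv c g

lemma slotLabel_eq_none {g : ℕ} (h : ∀ c, φ c ≠ g) : slotLabel φ g = none := by
  cases hg : slotLabel φ g with
  | none => rfl
  | some c => exact absurd ((slotLabel_eq_some hφ).1 hg) (h c)

end Query

/-- The effect of slot `g` in layer `l`. -/
noncomputable def cellOp (φ : CellLabel k C → ℕ) (y : CellLabel k C → Bool) (l g : ℕ) :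
    Equiv.Perm (CellState C) :=
  slotOp labelLayer labelSteer (Equiv.swap (.inr 2) (.inr 3)) y l (slotLabel φ g)

section Query

variable {φ : CellLabel k C → ℕ} (hφ : Function.Injective φ) {y : CellLabel k C → Bool} {l g : ℕ}
  {q : CellState C}

include hφ

/-- Outside its layer a label has trivial control, so its slot can only exchange the spare states
`2` and `3`, which the run never visits. -/
lemma cellOp_fix (hq2 : q ≠ .inr 2) (hq3 : q ≠ .inr 3)
    (h : ∀ c, φ c = g → y c = true → labelLayer c = l → q ≠ labelFst c ∧ q ≠ labelSnd c) :
    cellOp φ y l g q = q := by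
  unfold cellOp slotOp
  cases ho : slotLabel φ g with
  | none => rfl
  | some c =>
    have hc := h c ((slotLabel_eq_some hφ).1 ho)
    cases hy : y c with
    | false => simp [hy]
    | true =>
      by_cases hl : labelLayer c = l
      · obtain ⟨h1, h2⟩ := hc hy hl
        simp only [Option.elim_some, hy, if_true, onLayer, hl, labelSteer]
        rw [steer_conj (by simp) (labelFst_ne_labelSnd c), Equiv.swap_apply_of_ne_of_ne h1 h2]
      · simp [hy, onLayer, hl, Equiv.swap_apply_of_ne_of_ne hq2 hq3]

lemma cellOp_move {c : CellLabel k C} (hg : φ c = g) (hy : y c = true) (hl : labelLayer c = l) :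
    cellOp φ y l g = Equiv.swap (labelFst c) (labelSnd c) := by
  subst hg
  unfold cellOp slotOp
  simp only [slotLabel_apply hφ, Option.elim_some, hy, if_true, onLayer, hl, labelSteer]
  exact steer_conj (by simp) (labelFst_ne_labelSnd c)

end Query

section Trajectory

variable {φ : CellLabel k C → ℕ} (hφ : Function.Injective φ) {mid G : ℕ}
  (hφA : ∀ p, φ (.inl p) < mid) (hφB : ∀ p, mid ≤ φ (.inr p)) (hφG : ∀ c, φ c < G)
  (α : Fin (k - 1) → Fin C → Bool) (l₀ : Fin (k - 1)) (c₀ : Fin C)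

include hφ

/-- In these layers no query bit is set, and the contents of the cells move only states inside
cells. -/
lemma cellOp_idle {l : ℕ} (h0 : l ≠ l₀) (h1 : l ≠ l₀ + 1) (b : Bool) (g : ℕ) :
    cellOp φ (cellBits α (cellQuery l₀ c₀)) l g (.inr (if b then 1 else 0)) =
      .inr (if b then 1 else 0) := by
  refine cellOp_fix hφ (by cases b <;> simp) (by cases b <;> simp) ?_
  rintro (p | p) - hy hl
  · simp [labelFst, labelSnd]
  · simp only [cellBits, cellQuery, decide_eq_true_eq] at hy
    simp only [labelLayer] at hl
    omega

include hφA hφB hφG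

/-- The slots with contents precede those with queries, so the cell is entered too late for the
contents written in layer `l₀` to matter. -/
lemma seq_cellOp_open {z : ℕ → CellState C} (hz : ∀ g < G, z (g + 1) =
    cellOp φ (cellBits α (cellQuery l₀ c₀)) l₀ g (z g)) (h0 : z 0 = .inr 0) :
    z G = .inl (c₀, false) := by
  have hk : (l₀ : ℕ) < k := by omega
  let cB : CellLabel k C := .inr (⟨l₀, hk⟩, c₀, false)
  have honly : ∀ c : CellLabel k C, cellBits α (cellQuery l₀ c₀) c = true → labelLayer c = l₀ →
      c = cB ∨ ∃ p, c = .inl p := by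
    rintro (p | ⟨p, c, b⟩) hy hl
    · exact Or.inr ⟨p, rfl⟩
    · simp only [cellBits, cellQuery, decide_eq_true_eq] at hy
      simp only [labelLayer] at hl
      obtain ⟨rfl, h⟩ := hy
      have hb : b = false := by
        rcases h with h | h
        · exact h.2
        · omega
      subst hb
      exact Or.inl (by simp [cB, Fin.ext_iff, hl])
  refine seq_move (h := fun g => cellOp φ (cellBits α (cellQuery l₀ c₀)) l₀ g) (g₀ := φ cB)
    (fun g _ hg => hz g hg) (Nat.zero_le _) (hφG _) (fun g _ hg => ?_) ?_ (fun g hg hgG => ?_)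
  · rw [h0]
    refine cellOp_fix hφ (by simp) (by simp) ?_
    intro c hc hy hl
    rcases honly c hy hl with rfl | ⟨p, rfl⟩
    · omega
    · simp [labelFst, labelSnd]
  · rw [h0]
    rw [cellOp_move hφ (y := cellBits α (cellQuery l₀ c₀)) (l := l₀) (c := cB) rfl
      (by simp [cB, cellBits, cellQuery]) rfl]
    simp [cB, labelFst, labelSnd]
  · refine cellOp_fix hφ (by simp) (by simp) ?_
    intro c hc hy hl
    have hmid : mid ≤ φ cB := hφB (⟨l₀, hk⟩, c₀, false)
    rcases honly c hy hl with rfl | ⟨p, rfl⟩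
    · omega
    · have := hφA p
      omega

/-- Before `mid`, the content bit flips the cell from `false` to `true` if it is set; after `mid`,
the query for the resulting value lets the state out. The query for the other value touches neither
this cell state nor the state reached. -/
lemma seq_cellOp_read {z : ℕ → CellState C} (hz : ∀ g < G, z (g + 1) =
    cellOp φ (cellBits α (cellQuery l₀ c₀)) (l₀ + 1) g (z g)) (h0 : z 0 = .inl (c₀, false)) :
    z G = .inr (if α l₀ c₀ then 1 else 0) := by
  have hk : (l₀ : ℕ) + 1 < k := by omega
  set b := α l₀ c₀ with hb
  let cA : CellLabel k C := .inl (l₀, c₀)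
  let cB : Bool → CellLabel k C := fun b => .inr (⟨l₀ + 1, hk⟩, c₀, b)
  have hmidG : mid ≤ G := (hφB (⟨l₀ + 1, hk⟩, c₀, b)).trans (hφG _).le
  have honly : ∀ c : CellLabel k C, cellBits α (cellQuery l₀ c₀) c = true →
      labelLayer c = l₀ + 1 → (∃ b', c = cB b') ∨ ∃ c', c = .inl (l₀, c') := by
    rintro (⟨p, c⟩ | ⟨p, c, b'⟩) hy hl
    · simp only [labelLayer] at hl
      have : p = l₀ := by omega
      exact Or.inr ⟨c, by rw [this]⟩
    · simp only [cellBits, cellQuery, decide_eq_true_eq] at hy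
      simp only [labelLayer] at hl
      obtain ⟨rfl, h⟩ := hy
      exact Or.inl ⟨b', by simp [cB, Fin.ext_iff, hl]⟩
  have hA := hφA (l₀, c₀)
  have hfixA : ∀ b', ∀ g < mid, g ≠ φ cA →
      cellOp φ (cellBits α (cellQuery l₀ c₀)) (l₀ + 1) g (.inl (c₀, b')) = .inl (c₀, b') := by
    intro b' g hg hne
    refine cellOp_fix hφ (by simp) (by simp) ?_
    intro c hc hy hl
    rcases honly c hy hl with ⟨b', rfl⟩ | ⟨c', rfl⟩
    · have : mid ≤ φ (cB b') := hφB _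
      omega
    · have : c₀ ≠ c' := by
        rintro rfl
        exact hne hc.symm
      simp [labelFst, labelSnd, this]
  have e₁ : z mid = .inl (c₀, b) := by
    refine seq_move (h := fun g => cellOp φ (cellBits α (cellQuery l₀ c₀)) (l₀ + 1) g)
      (g₀ := φ cA) (fun g _ hg => hz g (by omega)) (Nat.zero_le _) hA (fun g _ hg => ?_) ?_
      (fun g hg hgm => hfixA b g hgm hg.ne')
    · rw [h0]
      exact hfixA false g (hg.trans hA) hg.ne
    · rw [h0]
      cases hb' : b with
      | false =>
        refine cellOp_fix hφ (by simp) (by simp) ?_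
        intro c hc hy hl
        obtain rfl := hφ hc
        simp [cA, cellBits, ← hb, hb'] at hy
      | true =>
        rw [cellOp_move hφ (y := cellBits α (cellQuery l₀ c₀)) (l := l₀ + 1) (c := cA) rfl
          (by simp [cA, cellBits, ← hb, hb']) rfl]
        simp [cA, labelFst, labelSnd]
  refine seq_move (h := fun g => cellOp φ (cellBits α (cellQuery l₀ c₀)) (l₀ + 1) g)
    (g₀ := φ (cB b)) (fun g _ hg => hz g hg) (hφB _) (hφG _) (fun g hgm hg => ?_) ?_
    (fun g hg hgG => ?_)
  · rw [e₁]
    refine cellOp_fix hφ (by simp) (by simp) ?_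
    intro c hc hy hl
    rcases honly c hy hl with ⟨b', rfl⟩ | ⟨c', rfl⟩
    · have : b ≠ b' := by
        rintro rfl
        omega
      simp [cB, labelFst, labelSnd, this]
    · have := hφA (l₀, c')
      omega
  · rw [e₁]
    rw [cellOp_move hφ (y := cellBits α (cellQuery l₀ c₀)) (l := l₀ + 1) (c := cB b) rfl
      (by simp [cB, cellBits, cellQuery]) rfl]
    simp [cB, labelFst, labelSnd]
  · refine cellOp_fix hφ (by cases b <;> simp) (by cases b <;> simp) ?_
    intro c hc hy hl
    rcases honly c hy hl with ⟨b', rfl⟩ | ⟨c', rfl⟩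
    · have : b ≠ b' := by
        rintro rfl
        omega
      revert this
      cases b <;> cases b' <;> simp [cB, labelFst, labelSnd]
    · have := hφA (l₀, c')
      have : mid ≤ φ (cB b) := hφB _
      omega

lemma cellFunction_query {n : ℕ} (hn : G * (2 * Fintype.card (CellLabel k C) + 1) ≤ n) :
    cellFunction k C n (slotInput n (slotLabel φ) (cellBits α (cellQuery l₀ c₀))) = α l₀ c₀ := by
  set L := 2 * Fintype.card (CellLabel k C) + 1 with hL
  set x := slotInput n (slotLabel φ) (cellBits α (cellQuery l₀ c₀)) with hx
  set st := permRun (cellProgram k C n) (.inr 0) x with hst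
  have hnone : ∀ g, G ≤ g → slotLabel φ g = none := fun g hg =>
    slotLabel_eq_none hφ fun c h => by
      have := hφG c
      omega
  have hslot : ∀ l, ∀ g < G, st (l * n + (g + 1) * L) =
      cellOp φ (cellBits α (cellQuery l₀ c₀)) l g (st (l * n + g * L)) :=
    fun l g hg => permRun_slotProgram_slot hn _ _ _ l hg
  have hlayer : ∀ l, st ((l + 1) * n) = st (l * n + G * L) :=
    fun l => permRun_slotProgram_layer hn hnone _ _ l
  have hidle : ∀ (l : ℕ) (b : Bool), l ≠ l₀ → l ≠ l₀ + 1 → st (l * n) = .inr (if b then 1 else 0) →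
      st ((l + 1) * n) = .inr (if b then 1 else 0) := by
    intro l b h0 h1 h
    rw [hlayer, ← h]
    have := seq_const (z := fun g => st (l * n + g * L))
      (h := fun g => cellOp φ (cellBits α (cellQuery l₀ c₀)) l g) (Nat.zero_le G)
      (fun g _ hg => hslot l g hg) (fun g _ _ => by
        simp only [zero_mul, add_zero]
        rw [h]
        exact cellOp_idle hφ α l₀ c₀ h0 h1 b g)
    simpa using this
  have h1 : ∀ l ≤ (l₀ : ℕ), st (l * n) = .inr 0 := by
    intro l hl
    induction l with
    | zero => rw [zero_mul]; rfl
    | succ l ih => exact hidle l false (by omega) (by omega) (ih (by omega))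
  have h2 : st ((l₀ + 1) * n) = .inl (c₀, false) := by
    rw [hlayer]
    exact seq_cellOp_open hφ hφA hφB hφG α l₀ c₀ (z := fun g => st (l₀ * n + g * L))
      (hslot l₀) (by simpa using h1 l₀ le_rfl)
  have h3 : ∀ l, (l₀ : ℕ) + 2 ≤ l → st (l * n) = .inr (if α l₀ c₀ then 1 else 0) := by
    intro l hl
    induction l, hl using Nat.le_induction with
    | base =>
      rw [hlayer]
      exact seq_cellOp_read hφ hφA hφB hφG α l₀ c₀ (z := fun g => st ((l₀ + 1) * n + g * L))
        (hslot (l₀ + 1)) (by simpa using h2)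
    | succ l hl ih => exact hidle l _ (by omega) (by omega) ih
  rw [cellFunction, ← hst, h3 k (by omega)]
  cases α l₀ c₀ <;> simp

/-- The contents of the cells give different rows. -/
lemma cellFunction_rowsSeparated {n : ℕ}
    (hn : G * (2 * Fintype.card (CellLabel k C) + 1) ≤ n) {R : Set (Fin n)}
    (hRA : ∀ p, ∀ v : Fin n, (v : ℕ) = φ (.inl p) * (2 * Fintype.card (CellLabel k C) + 1) +
      Fintype.card (CellLabel k C) → v ∈ R)
    (hRB : ∀ p, ∀ v : Fin n, (v : ℕ) = φ (.inr p) * (2 * Fintype.card (CellLabel k C) + 1) +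
      Fintype.card (CellLabel k C) → v ∉ R) :
    RowsSeparated (cellFunction k C n) R fun α : Fin (k - 1) → Fin C → Bool =>
      slotInput n (slotLabel φ) (cellBits α fun _ => false) := by
  intro α α' hne
  obtain ⟨l₀, hl⟩ := Function.ne_iff.1 hne
  obtain ⟨c₀, hc⟩ := Function.ne_iff.1 hl
  have hpos : ∀ (v : Fin n) c,
      slotLabel φ (v / (2 * Fintype.card (CellLabel k C) + 1)) = some c →
      (v : ℕ) % (2 * Fintype.card (CellLabel k C) + 1) = Fintype.card (CellLabel k C) →
      (v : ℕ) = φ c * (2 * Fintype.card (CellLabel k C) + 1) + Fintype.card (CellLabel k C) := by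
    intro v c h1 h2
    rw [slotLabel_eq_some hφ] at h1
    conv_lhs => rw [← Nat.div_add_mod v (2 * Fintype.card (CellLabel k C) + 1), h2, ← h1, mul_comm]
  have hin : ∀ α : Fin (k - 1) → Fin C → Bool, ∀ v ∈ R,
      slotInput n (slotLabel φ) (cellBits α (cellQuery l₀ c₀)) v =
        slotInput n (slotLabel φ) (cellBits α fun _ => false) v := by
    intro α v hv
    refine slotInput_congr fun c h1 h2 => ?_
    rcases c with p | p
    · rfl
    · exact absurd hv (hRB p v (hpos v _ h1 h2))
  refine ⟨_, _, hin α, hin α', fun v hv => slotInput_congr fun c h1 h2 => ?_, ?_⟩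
  · rcases c with p | p
    · exact absurd (hRA p v (hpos v _ h1 h2)) hv
    · rfl
  · rw [cellFunction_query hφ hφA hφB hφG α l₀ c₀ hn,
      cellFunction_query hφ hφA hφB hφG α' l₀ c₀ hn]
    exact hc

end Trajectory

end Universal

/-! ### A balanced cut for every order -/

section Cut

variable {n : ℕ}

/-- Every order has a cut such that each of the two families of `2 * m` variables contains `m`
variables on its own side of the cut. -/
lemma exists_cut (π : Equiv.Perm (Fin n)) {m : ℕ} {p p' : Fin (2 * m) → Fin n}
    (hp : Function.Injective p) :
    ∃ s ≤ n, ∃ R : Set (Fin n), (R = prefixSet π s ∨ R = (prefixSet π s)ᶜ) ∧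
      m ≤ Nat.card {g // p g ∈ R} ∧ m ≤ Nat.card {g // p' g ∉ R} := by
  classical
  let c : ℕ → ℕ := fun s => #{g | p g ∈ prefixSet π s}
  have hc0 : c 0 = 0 := by simp [c, prefixSet]
  have hcn : c n = 2 * m := by simp [c, prefixSet]
  have hcs : ∀ s, c (s + 1) ≤ c s + 1 := by
    intro s
    have hsub : ({g | p g ∈ prefixSet π (s + 1)} : Finset (Fin (2 * m))) ⊆
        ({g | p g ∈ prefixSet π s} : Finset (Fin (2 * m))) ∪
          ({g | (π.symm (p g) : ℕ) = s} : Finset (Fin (2 * m))) := by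
      intro g
      simp only [mem_prefixSet, mem_filter, mem_univ, true_and, mem_union]
      intro h
      omega
    refine (card_le_card hsub).trans ((card_union_le _ _).trans (Nat.add_le_add_left ?_ _))
    refine card_le_one.2 fun g hg g' hg' => ?_
    simp only [mem_filter, mem_univ, true_and] at hg hg'
    exact hp (π.symm.injective (Fin.ext (hg.trans hg'.symm)))
  -- Discrete intermediate value argument: `c` runs from `0` to `2 * m` in steps of at most one.
  obtain ⟨s, hsn, hs⟩ : ∃ s ≤ n, c s = m := by
    have hex : ∃ s, m ≤ c s := ⟨n, by omega⟩
    refine ⟨Nat.find hex, Nat.find_min' hex (by omega), le_antisymm ?_ (Nat.find_spec hex)⟩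
    cases h : Nat.find hex with
    | zero => omega
    | succ s =>
      have := Nat.find_min hex (m := s) (by omega)
      have := hcs s
      omega
  have hcard : ∀ (q : Fin (2 * m) → Fin n) (R : Set (Fin n)),
      Nat.card {g // q g ∈ R} + Nat.card {g // q g ∉ R} = 2 * m := by
    intro q R
    rw [Nat.card_eq_fintype_card, Nat.card_eq_fintype_card, Fintype.card_subtype_compl,
      Fintype.card_fin]
    have := Fintype.card_subtype_le fun g => q g ∈ R
    rw [Fintype.card_fin] at this
    omega
  have hs' : Nat.card {g // p g ∈ prefixSet π s} = m := by
    rw [Nat.card_eq_fintype_card, Fintype.card_subtype]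
    exact hs
  have h1 := hcard p (prefixSet π s)
  have h2 := hcard p' (prefixSet π s)
  -- The cut halves `p` exactly, so either side serves for it; the majority of `p'` decides which
  -- side becomes `R`.
  rcases le_or_gt m (Nat.card {g // p' g ∉ prefixSet π s}) with h | h
  · exact ⟨s, hsn, _, Or.inl rfl, hs'.ge, h⟩
  · refine ⟨s, hsn, _, Or.inr rfl, ?_, ?_⟩
    · simp only [Set.mem_compl_iff]
      omega
    · simp only [Set.mem_compl_iff, not_not]
      omega

end Cut

/-! ### Rows of the universal function for arbitrary and natural orders -/

section CellRows

variable {k C n : ℕ}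

/-- The contents of the cells give different rows on one side of a cut of any order. -/
theorem exists_cut_cellFunction_rowsSeparated
    (hn : 4 * Fintype.card (CellLabel k C) * (2 * Fintype.card (CellLabel k C) + 1) ≤ n)
    (π : Equiv.Perm (Fin n)) :
    ∃ s ≤ n, ∃ a : (Fin (k - 1) → Fin C → Bool) → Fin n → Bool,
      RowsSeparated (cellFunction k C n) (prefixSet π s) a ∨
        RowsSeparated (cellFunction k C n) (prefixSet π s)ᶜ a := by
  set m := Fintype.card (CellLabel k C) with hm
  have hpos : ∀ g < 4 * m, g * (2 * m + 1) + m < n := fun g hg =>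
    calc g * (2 * m + 1) + m < (g + 1) * (2 * m + 1) := by rw [Nat.succ_mul g]; omega
      _ ≤ 4 * m * (2 * m + 1) := Nat.mul_le_mul_right _ hg
      _ ≤ n := hn
  -- `p` and `p'` are the information variables of the first and of the last `2 * m` slots. Contents
  -- go to the former and queries to the latter, because `cellFunction` processes the slots in the
  -- natural order, whatever `π` is.
  let p : Fin (2 * m) → Fin n := fun g => ⟨g * (2 * m + 1) + m, hpos g (by omega)⟩
  let p' : Fin (2 * m) → Fin n := fun g => ⟨(2 * m + g) * (2 * m + 1) + m, hpos _ (by omega)⟩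
  have hp : Function.Injective p := by
    intro g g' h
    have h := congrArg Fin.val h
    simp only [p, Nat.add_right_cancel_iff] at h
    exact Fin.ext (Nat.eq_of_mul_eq_mul_right (Nat.succ_pos _) h)
  obtain ⟨s, hs, R, hR, hA, hB⟩ := exists_cut π (p' := p') hp
  have hcA : Fintype.card (Fin (k - 1) × Fin C) ≤ m := by
    rw [hm, Fintype.card_sum]
    exact Nat.le_add_right _ _
  have hcB : Fintype.card (Fin k × Fin C × Bool) ≤ m := by
    rw [hm, Fintype.card_sum]
    exact Nat.le_add_left _ _
  classical
  obtain ⟨eA⟩ : Nonempty (Fin (k - 1) × Fin C ↪ {g // p g ∈ R}) := by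
    refine Function.Embedding.nonempty_of_card_le (hcA.trans ?_)
    rwa [← Nat.card_eq_fintype_card]
  obtain ⟨eB⟩ : Nonempty (Fin k × Fin C × Bool ↪ {g // p' g ∉ R}) := by
    refine Function.Embedding.nonempty_of_card_le (hcB.trans ?_)
    rwa [← Nat.card_eq_fintype_card]
  let φ : CellLabel k C → ℕ := Sum.elim (fun a => (eA a).1) (fun b => 2 * m + (eB b).1)
  have hφ : Function.Injective φ := by
    rintro (a | b) (a' | b') h
    · simp only [φ, Sum.elim_inl] at h
      rw [eA.injective (Subtype.ext (Fin.ext h))]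
    · have := (eA a).1.2
      simp only [φ, Sum.elim_inl, Sum.elim_inr] at h
      omega
    · have := (eA a').1.2
      simp only [φ, Sum.elim_inl, Sum.elim_inr] at h
      omega
    · simp only [φ, Sum.elim_inr, Nat.add_left_cancel_iff] at h
      rw [eB.injective (Subtype.ext (Fin.ext h))]
  have h := cellFunction_rowsSeparated (mid := 2 * m) (G := 4 * m) (n := n) hφ
    (fun a => (eA a).1.2) (fun b => Nat.le_add_right _ _)
    (by
      rintro (a | b)
      · have := (eA a).1.2
        simp only [φ, Sum.elim_inl]
        omega
      · have := (eB b).1.2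
        simp only [φ, Sum.elim_inr]
        omega) (R := R) hn
    (fun a v hv => by
      have : v = p (eA a).1 := Fin.ext hv
      rw [this]
      exact (eA a).2)
    (fun b v hv => by
      have : v = p' (eB b).1 := Fin.ext hv
      rw [this]
      exact (eB b).2)
  refine ⟨s, hs, fun α => slotInput n (slotLabel φ) (cellBits α fun _ => false), ?_⟩
  rcases hR with rfl | rfl
  · exact Or.inl h
  · exact Or.inr h

/-- In the natural order, the contents of the cells give different rows on the first half. -/
theorem cellFunction_rowsSeparated_natural
    (hn : 4 * Fintype.card (CellLabel k C) * (2 * Fintype.card (CellLabel k C) + 1) < n) :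
    ∃ s < n, ∃ a : (Fin (k - 1) → Fin C → Bool) → Fin n → Bool,
      RowsSeparated (cellFunction k C n) (prefixSet 1 s) a := by
  set m := Fintype.card (CellLabel k C) with hm
  let e := Fintype.equivFin (CellLabel k C)
  let φ : CellLabel k C → ℕ := fun c => (if c.isLeft then 0 else 2 * m) + e c
  have hlt : ∀ c, (e c : ℕ) < m := fun c => (e c).2
  have hφ : Function.Injective φ := by
    intro c c' h
    have h1 := hlt c
    have h2 := hlt c'
    have : (e c : ℕ) = e c' := by
      simp only [φ] at h
      split_ifs at h <;> omega
    exact e.injective (Fin.ext this)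
  have hφA : ∀ a, φ (.inl a) < 2 * m := fun a => by
    have := hlt (.inl a)
    simp only [φ, Sum.isLeft_inl, if_true]
    omega
  have hφB : ∀ b, 2 * m ≤ φ (.inr b) := fun b => by simp [φ]
  have hle : 2 * m * (2 * m + 1) ≤ 4 * m * (2 * m + 1) := Nat.mul_le_mul_right _ (by omega)
  refine ⟨2 * m * (2 * m + 1), hle.trans_lt hn, _,
    cellFunction_rowsSeparated (mid := 2 * m) (G := 4 * m) hφ hφA hφB (fun c => ?_) hn.le
      (fun a v hv => ?_) fun b v hv => ?_⟩
  · have := hlt c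
    simp only [φ]
    split_ifs <;> omega
  · rw [mem_prefixSet_one, hv, ← hm]
    calc φ (.inl a) * (2 * m + 1) + m < (φ (.inl a) + 1) * (2 * m + 1) := by
          rw [Nat.succ_mul (φ (.inl a))]; omega
      _ ≤ 2 * m * (2 * m + 1) := Nat.mul_le_mul_right _ (hφA a)
  · rw [mem_prefixSet_one, hv, ← hm, not_lt]
    exact (Nat.mul_le_mul_right _ (hφB b)).trans (Nat.le_add_right _ _)

end CellRows

/-! ### Comparison of the bounds -/

section Numerics

variable {k d w : ℕ}

lemma det_bound_lt (hk : 2 ≤ k) (hwd : 32 * (w + 3) ≤ d) :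
    (w + 1) ^ ((w + 1) * k) < d ^ ((k - 1) * (d - 1)) := by
  have h1 : (w + 1) * k < (k - 1) * (d - 1) := by
    obtain ⟨j, rfl⟩ : ∃ j, k = j + 2 := ⟨k - 2, by omega⟩
    calc (w + 1) * (j + 2) ≤ (w + 1) * (2 * (j + 1)) := Nat.mul_le_mul_left _ (by omega)
      _ = (j + 1) * (2 * (w + 1)) := by ring
      _ < (j + 1) * (d - 1) := Nat.mul_lt_mul_of_pos_left (by omega) (by omega)
      _ = _ := rfl
  calc (w + 1) ^ ((w + 1) * k) ≤ d ^ ((w + 1) * k) := Nat.pow_le_pow_left (by omega) _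
    _ < _ := Nat.pow_lt_pow_right (by omega) h1

lemma logb_two_pow_le {B X Y : ℕ} (hd : 0 < d) (h : d ^ X ≤ B ^ Y) :
    (X : ℝ) * Real.logb 2 d ≤ Y * Real.logb 2 B := by
  have h' : ((d : ℝ) ^ X) ≤ (B : ℝ) ^ Y := by exact_mod_cast h
  rw [← Real.logb_pow, ← Real.logb_pow]
  exact Real.logb_le_logb_of_le one_lt_two (by positivity) h'

lemma nondet_bound_lt (hk : 2 ≤ k) (hd : 2 ≤ d)
    (hwd : (w : ℝ) ^ 2 ≤ d * Real.logb 2 d / 33) :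
    2 ^ (k * w ^ 2) < d ^ ((k - 1) * (d - 1)) := by
  by_contra! h
  have h := logb_two_pow_le (by omega) h
  rw [Nat.cast_two, Real.logb_self_eq_one one_lt_two, mul_one] at h
  obtain ⟨j, rfl⟩ : ∃ j, k = j + 2 := ⟨k - 2, by omega⟩
  obtain ⟨c, rfl⟩ : ∃ c, d = c + 2 := ⟨d - 2, by omega⟩
  have hlog : 0 < Real.logb 2 ((c + 2 : ℕ) : ℝ) :=
    Real.logb_pos one_lt_two (by exact_mod_cast (show 1 < c + 2 by omega))
  rw [show j + 2 - 1 = j + 1 by omega, show c + 2 - 1 = c + 1 by omega] at h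
  push_cast at h hwd hlog
  set y := Real.logb 2 ((c : ℝ) + 2)
  have hj : (0 : ℝ) ≤ j := j.cast_nonneg
  have hc : (0 : ℝ) ≤ c := c.cast_nonneg
  have h1 : ((j : ℝ) + 2) * (w : ℝ) ^ 2 ≤ (2 * (j + 1)) * ((c + 2) * y / 33) :=
    mul_le_mul (by linarith) hwd (by positivity) (by positivity)
  have h2 : 0 < (j + 1) * y * ((c + 1) - 2 * (c + 2) / 33) := by
    refine mul_pos (by positivity) (by linarith)
  nlinarith

lemma logb_natCast_le_half (hw : 0 < w) (h : (w : ℝ) ^ 2 ≤ d) :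
    Real.logb 2 w ≤ Real.logb 2 d / 2 := by
  have := Real.logb_le_logb_of_le one_lt_two (by positivity) h
  rw [Real.logb_pow] at this
  push_cast at this
  linarith

/-- In `prob_bound_lt` the slack is `5 / 16` of `log d`, against `23 / 4 + 5 / 4 * log (1 / ε)`.
This explains the exponent 4 of `ε`, and `2 ^ 20` covers the constant `92 / 5`. -/
lemma log_threshold {ε : ℝ} (hε : 0 < ε) (hd : 2 ^ 20 / ε ^ 4 < (d : ℝ)) :
    20 + 4 * Real.logb 2 (1 / ε) < Real.logb 2 d := by
  have := Real.logb_lt_logb one_lt_two (by positivity) hd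
  rw [div_eq_mul_one_div, Real.logb_mul (by positivity) (by positivity), ← one_div_pow,
    Real.logb_pow, Real.logb_pow, Real.logb_self_eq_one one_lt_two] at this
  push_cast at this
  linarith

lemma one_le_logb_inv {ε : ℝ} (hε : 0 < ε) (hε2 : ε ≤ 1 / 2) : 1 ≤ Real.logb 2 (1 / ε) := by
  rw [Real.le_logb_iff_rpow_le one_lt_two (by positivity), Real.rpow_one, le_div_iff₀ hε]
  linarith

/-- Rounding to multiples of `1 / N` with `N = ⌈c / ε⌉`. -/
lemma logb_ceil_le {c ε : ℝ} (hε : 0 < ε) (hε2 : ε ≤ 1 / 2) (hc : 1 ≤ c) :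
    0 < ⌈c / ε⌉₊ ∧ c / ⌈c / ε⌉₊ < 2 * ε ∧
      Real.logb 2 ((2 * ⌈c / ε⌉₊ + 1 : ℕ) : ℝ) ≤ 3 + Real.logb 2 c + Real.logb 2 (1 / ε) := by
  have hpos : 0 < c / ε := by positivity
  have hN : 0 < ⌈c / ε⌉₊ := Nat.ceil_pos.2 hpos
  have hN' : (0 : ℝ) < ⌈c / ε⌉₊ := by exact_mod_cast hN
  have h1 := Nat.le_ceil (c / ε)
  have h2 := Nat.ceil_lt_add_one hpos.le
  have h3 : 1 ≤ c / ε := by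
    rw [le_div_iff₀ hε]
    linarith
  refine ⟨hN, ?_, ?_⟩
  · rw [div_le_iff₀ hε] at h1
    rw [div_lt_iff₀ hN']
    nlinarith
  -- The left side is at most `2 * (c / ε) + 3`, hence at most `5 * (c / ε)`; the factor 8 has an
  -- integral logarithm.
  · have h4 : ((2 * ⌈c / ε⌉₊ + 1 : ℕ) : ℝ) ≤ 2 ^ 3 * c * (1 / ε) := by
      push_cast
      rw [mul_assoc, mul_one_div]
      linarith
    refine (Real.logb_le_logb_of_le one_lt_two (by positivity) h4).trans (le_of_eq ?_)
    rw [Real.logb_mul (by positivity) (by positivity), Real.logb_mul (by positivity)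
      (by positivity), Real.logb_pow, Real.logb_self_eq_one one_lt_two]
    norm_num

/-- The logarithm of the grid size is at most `log k + log w + log (1 / ε) + 3`. The hypothesis on
`w` turns the share of `log k` into at most `2 * (k - 1) * d`. Since `log w` is at most half of `log
d`, the main term is about `5 / 8` of `(k - 1) * d * log d`, and `15 / 16` of it is available. -/
lemma prob_bound_lt {ε : ℝ} (hk : 2 ≤ k) (hw : 0 < w) (hε : 0 < ε) (hε2 : ε ≤ 1 / 2)
    (hd : 2 ^ 20 / ε ^ 4 < (d : ℝ)) (hwd : (w : ℝ) ^ 2 ≤ d / Real.logb 2 k) :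
    (2 * ⌈(k * w : ℝ) / ε⌉₊ + 1) ^ ((k - 1) * w ^ 2 + w) < d ^ ((k - 1) * (d - 1)) := by
  have hd0 : 0 < d := by
    have : (0 : ℝ) < d := lt_trans (by positivity) hd
    exact_mod_cast this
  have hk' : (2 : ℝ) ≤ k := by exact_mod_cast hk
  have hw' : (1 : ℝ) ≤ w := by exact_mod_cast hw
  obtain ⟨-, -, hN⟩ := logb_ceil_le (c := (k * w : ℝ)) hε hε2 (by nlinarith)
  rw [Real.logb_mul (by positivity) (by positivity)] at hN
  have hlk : 1 ≤ Real.logb 2 k := by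
    rw [Real.le_logb_iff_rpow_le one_lt_two (by positivity), Real.rpow_one]
    exact hk'
  rw [le_div_iff₀ (by linarith)] at hwd
  have hwd' : (w : ℝ) ^ 2 ≤ d := by nlinarith [sq_nonneg (w : ℝ)]
  have hlw := logb_natCast_le_half hw hwd'
  have hld := log_threshold hε hd
  have hlε := one_le_logb_inv hε hε2
  have hd16 : (16 : ℝ) ≤ d := by
    have : (1 : ℝ) ≤ 1 / ε ^ 4 := by
      rw [le_div_iff₀ (by positivity), one_mul]
      exact pow_le_one₀ hε.le (by linarith)
    have h2 : (2 : ℝ) ^ 20 / ε ^ 4 = 2 ^ 20 * (1 / ε ^ 4) := by ring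
    nlinarith
  have hw4 : (w : ℝ) ≤ d / 4 := by nlinarith
  by_contra! h
  have h := logb_two_pow_le hd0 h
  push_cast [Nat.cast_sub (show 1 ≤ k by omega), Nat.cast_sub (show 1 ≤ d by omega)] at h hN
  set A := Real.logb 2 (2 * (⌈(k * w : ℝ) / ε⌉₊ : ℝ) + 1)
  set y := Real.logb 2 (d : ℝ)
  set K := (k : ℝ) - 1 with hK
  set lk := Real.logb 2 (k : ℝ)
  set lw := Real.logb 2 (w : ℝ)
  set e := Real.logb 2 (1 / ε)
  have hK1 : 1 ≤ K := by linarith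
  set F := 3 + e + y / 2 with hF
  have hF0 : 0 < F := by linarith
  have hA : A ≤ lk + F := by linarith
  have h1 : (K * (w : ℝ) ^ 2 + w) * A ≤ (K * (w : ℝ) ^ 2 + w) * (lk + F) :=
    mul_le_mul_of_nonneg_left hA (by positivity)
  have h2 : (K * (w : ℝ) ^ 2) * lk ≤ K * d := by nlinarith
  have h3 : (w : ℝ) * lk ≤ K * d :=
    calc (w : ℝ) * lk ≤ (w : ℝ) ^ 2 * lk :=
          mul_le_mul_of_nonneg_right (le_self_pow₀ hw' two_ne_zero) (by linarith)
      _ ≤ d := hwd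
      _ ≤ K * d := le_mul_of_one_le_left d.cast_nonneg hK1
  have h4 : (K * (w : ℝ) ^ 2 + w) * F ≤ (5 / 4 * (K * d)) * F :=
    mul_le_mul_of_nonneg_right (by nlinarith) hF0.le
  have h5 : K * (d - 1) * y ≥ K * d * (15 / 16 * y) := by
    have : 0 ≤ K * y * (d / 16 - 1) := mul_nonneg (mul_nonneg (by linarith) (by linarith))
      (by linarith)
    nlinarith
  have h6 : 0 < K * d * (15 / 16 * y - (2 + 5 / 4 * F)) := by
    refine mul_pos (by positivity) ?_
    rw [hF]
    linarith
  nlinarith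

/-- The constant 16 makes the exponent `2 * (k * w ^ 2)` at most `d / 8`. The factor `k` in the
hypothesis leaves the factor `k - 1` of the right side unused, and this absorbs `log k ≤ k - 1`. -/
lemma quantum_bound_lt {ε : ℝ} (hk : 2 ≤ k) (hw : 0 < w) (hε : 0 < ε) (hε2 : ε ≤ 1 / 2)
    (hd : 2 ^ 20 / ε ^ 4 < (d : ℝ)) (hwd : (w : ℝ) ^ 2 ≤ d / (16 * k)) :
    (2 * ⌈(4 * k * w ^ 3 : ℝ) / ε⌉₊ + 1) ^ (2 * (k * w ^ 2)) < d ^ ((k - 1) * (d - 1)) := by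
  have hd0 : 0 < d := by
    have : (0 : ℝ) < d := lt_trans (by positivity) hd
    exact_mod_cast this
  have hk' : (2 : ℝ) ≤ k := by exact_mod_cast hk
  have hw' : (1 : ℝ) ≤ w := by exact_mod_cast hw
  obtain ⟨-, -, hN⟩ := logb_ceil_le (c := (4 * k * w ^ 3 : ℝ)) hε hε2
    (by nlinarith [one_le_pow₀ hw' (n := 3)])
  rw [Real.logb_mul (by positivity) (by positivity), Real.logb_mul (by positivity) (by positivity),
    Real.logb_pow, show (4 : ℝ) = 2 ^ 2 by norm_num, Real.logb_pow,
    Real.logb_self_eq_one one_lt_two] at hN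
  rw [le_div_iff₀ (by positivity)] at hwd
  have hwd' : (w : ℝ) ^ 2 ≤ d := by nlinarith [sq_nonneg (w : ℝ)]
  have hlw := logb_natCast_le_half hw hwd'
  have hld := log_threshold hε hd
  have hlε := one_le_logb_inv hε hε2
  have hlk : Real.logb 2 k ≤ k - 1 := by
    rw [Real.logb_le_iff_le_rpow one_lt_two (by positivity),
      show (k : ℝ) - 1 = ((k - 1 : ℕ) : ℝ) by push_cast [Nat.cast_sub (show 1 ≤ k by omega)]; rfl,
      Real.rpow_natCast]
    have := Nat.lt_two_pow_self (n := k - 1)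
    exact_mod_cast (show k ≤ 2 ^ (k - 1) by omega)
  have hd16 : (16 : ℝ) ≤ d := by nlinarith
  by_contra! h
  have h := logb_two_pow_le hd0 h
  push_cast [Nat.cast_sub (show 1 ≤ k by omega), Nat.cast_sub (show 1 ≤ d by omega)] at h hN
  rw [show (2 : ℝ) ^ 2 = 4 by norm_num] at hN
  set A := Real.logb 2 (2 * (⌈(4 * k * w ^ 3 : ℝ) / ε⌉₊ : ℝ) + 1)
  set y := Real.logb 2 (d : ℝ)
  set K := (k : ℝ) - 1 with hK
  set lk := Real.logb 2 (k : ℝ)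
  set lw := Real.logb 2 (w : ℝ)
  set e := Real.logb 2 (1 / ε)
  have hK1 : 1 ≤ K := by linarith
  set F := 5 + e + 3 / 2 * y + 1 with hF
  have hF0 : 0 < F := by linarith
  have hA : A ≤ K * F := by nlinarith
  have h1 : 2 * ((k : ℝ) * (w : ℝ) ^ 2) * A ≤ 2 * ((k : ℝ) * (w : ℝ) ^ 2) * (K * F) :=
    mul_le_mul_of_nonneg_left hA (by positivity)
  have h2 : 2 * ((k : ℝ) * (w : ℝ) ^ 2) * (K * F) ≤ d / 8 * (K * F) :=
    mul_le_mul_of_nonneg_right (by linarith) (by positivity)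
  have h5 : K * (d - 1) * y ≥ K * d * (15 / 16 * y) := by
    have : 0 ≤ K * y * (d / 16 - 1) := mul_nonneg (mul_nonneg (by linarith) (by linarith))
      (by linarith)
    nlinarith
  have h6 : 0 < K * d * (15 / 16 * y - F / 8) := by
    refine mul_pos (by positivity) ?_
    rw [hF]
    linarith
  nlinarith

/-- From `d ^ 2 ≤ 2 ^ d` the square of `d ^ (d - 1)` is at most `2 ^ (d ^ 2 - d)`. The four spare
states and the rounding of the number of cells cost at most 5 in the exponent, whence `5 ≤ d`. -/
lemma pow_le_two_pow_of_five_le (k : ℕ) (hd : 5 ≤ d) :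
    d ^ ((k - 1) * (d - 1)) ≤ (2 ^ ((d ^ 2 - 4) / 2)) ^ (k - 1) := by
  rw [mul_comm, pow_mul]
  refine Nat.pow_le_pow_left ?_ _
  have hsq : d ^ 2 ≤ 2 ^ d := by
    induction d, (show 4 ≤ d by omega) using Nat.le_induction with
    | base => norm_num
    | succ d hd4 ih =>
      rcases hd4.eq_or_lt with rfl | h
      · norm_num
      · have := ih (by omega)
        rw [pow_succ 2]
        nlinarith
  refine (Nat.pow_le_pow_iff_left two_ne_zero).1 ?_
  calc (d ^ (d - 1)) ^ 2 = (d ^ 2) ^ (d - 1) := by rw [← pow_mul, ← pow_mul, mul_comm]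
    _ ≤ (2 ^ d) ^ (d - 1) := Nat.pow_le_pow_left hsq _
    _ = 2 ^ (d * (d - 1)) := by rw [← pow_mul]
    _ ≤ 2 ^ ((d ^ 2 - 4) / 2 * 2) := by
      refine Nat.pow_le_pow_right two_pos ?_
      have : d * (d - 1) + d = d ^ 2 := by
        obtain ⟨c, rfl⟩ : ∃ c, d = c + 1 := ⟨d - 1, by omega⟩
        rw [Nat.add_sub_cancel]
        ring
      omega
    _ = _ := by rw [pow_mul]

end Numerics

/-! ### From the number of rows to the lower bounds for the classes -/

section Classes

variable {k n d : ℕ} {f : (Fin n → Bool) → Bool} {ι : Type*} [Fintype ι]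

lemma mul_add_three_le_of_le_floor {w : ℕ} (h : (w : ℝ) ≤ (⌊(d : ℝ) / 32⌋ : ℝ) - 3) : 32 * (w + 3) ≤ d := by
  have h1 := Int.floor_le ((d : ℝ) / 32)
  have h2 : 32 * ((w : ℝ) + 3) ≤ d := by linarith
  exact_mod_cast h2

theorem DetOBDD.not_computes (hk : 2 ≤ k) (hn : 0 < n)
    (hι : 5 ≤ d → d ^ ((k - 1) * (d - 1)) ≤ Fintype.card ι) (P : DetOBDD k n)
    (hP : (P.width : ℝ) ≤ (⌊(d : ℝ) / 32⌋ : ℝ) - 3) {s : ℕ} (hs : s ≤ n) {a : ι → Fin n → Bool}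
    (ha : RowsSeparated f (prefixSet P.order s) a ∨ RowsSeparated f (prefixSet P.order s)ᶜ a) :
    ¬ P.Computes f := by
  intro hf
  have hw := mul_add_three_le_of_le_floor hP
  have h1 := P.card_rows_le (Nat.mul_pos (by omega) hn) le_rfl hf hs ha
  exact absurd (det_bound_lt hk hw) (not_lt.2 ((hι (by omega)).trans h1))

theorem notMem_classOBDD (hk : 2 ≤ k) (hn : 0 < n)
    (hι : 5 ≤ d → d ^ ((k - 1) * (d - 1)) ≤ Fintype.card ι)
    (hf : ∀ π : Equiv.Perm (Fin n), ∃ s ≤ n, ∃ a : ι → Fin n → Bool,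
      RowsSeparated f (prefixSet π s) a ∨ RowsSeparated f (prefixSet π s)ᶜ a) :
    f ∉ classOBDD k n ((⌊(d : ℝ) / 32⌋ : ℝ) - 3) := by
  rintro ⟨P, hP, hc⟩
  obtain ⟨s, hs, a, ha⟩ := hf P.order
  exact P.not_computes hk hn hι hP hs ha hc

variable {s : ℕ} {a : ι → Fin n → Bool}

theorem notMem_classIdOBDD (hk : 2 ≤ k)
    (hι : 5 ≤ d → d ^ ((k - 1) * (d - 1)) ≤ Fintype.card ι) (hs : s < n)
    (ha : RowsSeparated f (prefixSet 1 s) a) :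
    f ∉ classIdOBDD k n ((⌊(d : ℝ) / 32⌋ : ℝ) - 3) := by
  rintro ⟨P, hP1, hP, hc⟩
  rw [← hP1] at ha
  exact P.not_computes hk (by omega) hι hP hs.le (Or.inl ha) hc

/-- For `d ≤ 4` one has `d * log d ≤ 8 < 33`, so the width bound is below one and the class is
empty. -/
lemma five_le_of_le_nondet {w : ℕ} (hw : 0 < w) (hd : 2 ≤ d)
    (h : (w : ℝ) ^ 2 ≤ d * Real.logb 2 d / 33) : 5 ≤ d := by
  by_contra! hlt
  have hw' : (1 : ℝ) ≤ (w : ℝ) ^ 2 := one_le_pow₀ (by exact_mod_cast hw)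
  have hd4 : (d : ℝ) ≤ 2 ^ 2 := by exact_mod_cast (show d ≤ 2 ^ 2 by omega)
  have hd0 : (0 : ℝ) < d := by positivity
  have hlog := Real.logb_le_logb_of_le one_lt_two hd0 hd4
  rw [Real.logb_pow, Real.logb_self_eq_one one_lt_two] at hlog
  have : (d : ℝ) * Real.logb 2 d ≤ 2 ^ 2 * 2 := by
    refine mul_le_mul hd4 (by simpa using hlog) (Real.logb_nonneg one_lt_two ?_) (by norm_num)
    exact_mod_cast (show 1 ≤ d by omega)
  linarith

lemma sq_le_of_le_sqrt {w W : ℝ} (hw : 0 < w) (h : w ≤ √W) : w ^ 2 ≤ W :=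
  (Real.le_sqrt' hw).1 h

theorem notMem_classIdNOBDD (hk : 2 ≤ k) (hd : 2 ≤ d)
    (hι : 5 ≤ d → d ^ ((k - 1) * (d - 1)) ≤ Fintype.card ι) (hs : s < n)
    (ha : RowsSeparated f (prefixSet 1 s) a) :
    f ∉ classIdNOBDD k n (√((d : ℝ) * Real.logb 2 d / 33)) := by
  rintro ⟨P, hP1, hP, hc⟩
  rw [← hP1] at ha
  have hw : 0 < P.width := lt_of_lt_of_le (Fin.pos P.source)
    (P.size_le le_rfl (Nat.mul_pos (by omega) (by omega)))
  have hsq := sq_le_of_le_sqrt (by exact_mod_cast hw) hP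
  have h1 := P.card_rows_le le_rfl hc hs ha
  exact absurd (nondet_bound_lt hk hd hsq)
    (not_lt.2 ((hι (five_le_of_le_nondet hw hd hsq)).trans h1))

/-- The threshold for `d` in the bounds for probabilistic and quantum programs. -/
noncomputable def marginThreshold (ε : ℝ) : ℕ := ⌈2 ^ 20 / ε ^ 4⌉₊ + 5

lemma lt_of_marginThreshold_le {ε : ℝ} (h : marginThreshold ε ≤ d) :
    2 ^ 20 / ε ^ 4 < (d : ℝ) := by
  have h1 : ⌈(2 : ℝ) ^ 20 / ε ^ 4⌉₊ < d := by
    unfold marginThreshold at h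
    omega
  exact (Nat.le_ceil _).trans_lt (by exact_mod_cast h1)

theorem notMem_classIdPOBDD {ε : ℝ} (hk : 2 ≤ k) (hε : 0 < ε) (hε2 : ε ≤ 1 / 2)
    (hd : marginThreshold ε ≤ d)
    (hι : 5 ≤ d → d ^ ((k - 1) * (d - 1)) ≤ Fintype.card ι) (hs : s < n)
    (ha : RowsSeparated f (prefixSet 1 s) a) :
    f ∉ classIdPOBDD k n ε (√((d : ℝ) / Real.logb 2 k)) := by
  rintro ⟨P, hP1, hP, hc⟩
  rw [← hP1] at ha
  have hw : 0 < P.width := lt_of_lt_of_le (Fin.pos P.source)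
    (P.size_le le_rfl (Nat.mul_pos (by omega) (by omega)))
  have hsq := sq_le_of_le_sqrt (by exact_mod_cast hw) hP
  have hkw : (1 : ℝ) ≤ k * P.width := by exact_mod_cast Nat.mul_pos (by omega) hw
  obtain ⟨hN, hNε, -⟩ := logb_ceil_le hε hε2 hkw
  have h1 := P.card_rows_le le_rfl hc hs (by omega) ha hN hNε
  exact absurd (prob_bound_lt hk hw hε hε2 (lt_of_marginThreshold_le hd) hsq)
    (not_lt.2 ((hι ((Nat.le_add_left 5 _).trans hd)).trans h1))

theorem notMem_classIdQOBDD {ε : ℝ} (hk : 2 ≤ k) (hε : 0 < ε) (hε2 : ε ≤ 1 / 2)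
    (hd : marginThreshold ε ≤ d)
    (hι : 5 ≤ d → d ^ ((k - 1) * (d - 1)) ≤ Fintype.card ι) (hs : s < n)
    (ha : RowsSeparated f (prefixSet 1 s) a) :
    f ∉ classIdQOBDD k n ε (√((d : ℝ) / (16 * k))) := by
  rintro ⟨w, P, hP1, hP, hc⟩
  rw [← hP1] at ha
  have hw : 0 < w := Fin.pos P.source
  have hsq := sq_le_of_le_sqrt (by exact_mod_cast hw) hP
  have hkw : (1 : ℝ) ≤ 4 * k * w ^ 3 := by
    exact_mod_cast Nat.mul_pos (show 0 < 4 * k by omega) (pow_pos hw 3)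
  obtain ⟨hN, hNε, -⟩ := logb_ceil_le hε hε2 hkw
  have h1 := P.card_rows_le hc hs.le ha hN hNε
  exact absurd (quantum_bound_lt hk hw hε hε2 (lt_of_marginThreshold_le hd) hsq)
    (not_lt.2 ((hι ((Nat.le_add_left 5 _).trans hd)).trans h1))

end Classes

/-! ### The main theorem -/

theorem mainTheorem4 :
    ∃ (C₁ : ℝ) (D : ℝ → ℕ), 0 < C₁ ∧
      -- a function that is hard for every order of the variables
      (∀ k d : ℕ, 2 ≤ k → 2 ≤ d → ∃ n₀ : ℕ, ∀ n ≥ n₀, ∃ f : (Fin n → Bool) → Bool,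
        f ∈ classIdOBDD k n ((d : ℝ) ^ 2) ∧
        f ∈ classIdNOBDD k n ((d : ℝ) ^ 2) ∧
        (∀ ε : ℝ, 0 < ε → ε ≤ 1 / 2 →
          f ∈ classIdPOBDD k n ε ((d : ℝ) ^ 2) ∧ f ∈ classIdQOBDD k n ε ((d : ℝ) ^ 2)) ∧
        f ∉ classOBDD k n ((⌊(d : ℝ) / 32⌋ : ℝ) - 3) ∧
        f ∉ classIdNOBDD k n (√((d : ℝ) * Real.logb 2 d / 33)) ∧
        (∀ ε : ℝ, 0 < ε → ε ≤ 1 / 2 → D ε ≤ d →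
          f ∉ classIdPOBDD k n ε (√((d : ℝ) / Real.logb 2 k)) ∧
          f ∉ classIdQOBDD k n ε (√((d : ℝ) / (C₁ * k))))) ∧
      -- matrix XOR pointer jumping, for the natural order
      (∀ k d t n : ℕ, 2 ≤ k → 1 ≤ t → d = 2 ^ t → 2 * k * d * t ≤ n →
        mxpj k t n ∈ classIdOBDD k n ((d : ℝ) ^ 2) ∧
        mxpj k t n ∈ classIdNOBDD k n ((d : ℝ) ^ 2) ∧
        (∀ ε : ℝ, 0 < ε → ε ≤ 1 / 2 →
          mxpj k t n ∈ classIdPOBDD k n ε ((d : ℝ) ^ 2) ∧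
          mxpj k t n ∈ classIdQOBDD k n ε ((d : ℝ) ^ 2)) ∧
        mxpj k t n ∉ classIdOBDD k n ((⌊(d : ℝ) / 32⌋ : ℝ) - 3) ∧
        mxpj k t n ∉ classIdNOBDD k n (√((d : ℝ) * Real.logb 2 d / 33)) ∧
        (∀ ε : ℝ, 0 < ε → ε ≤ 1 / 2 → D ε ≤ d →
          mxpj k t n ∉ classIdPOBDD k n ε (√((d : ℝ) / Real.logb 2 k)) ∧
          mxpj k t n ∉ classIdQOBDD k n ε (√((d : ℝ) / (C₁ * k))))) := by
  refine ⟨16, marginThreshold, by norm_num, fun k d hk hd => ?_, fun k d t n hk ht hdt hn => ?_⟩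
  -- The largest number of cells for which the `2 * C + 4` states fit into width `d ^ 2`.
  · set C := (d ^ 2 - 4) / 2 with hC
    have hd2 : 2 ^ 2 ≤ d ^ 2 := Nat.pow_le_pow_left hd 2
    -- Room for `4 * m` slots, where `m` is the number of labels. For `d = 2` there are no cells and
    -- hence no labels, and the `+ 1` keeps `n` positive.
    refine ⟨4 * Fintype.card (CellLabel k C) * (2 * Fintype.card (CellLabel k C) + 1) + 1,
      fun n hn => ⟨cellFunction k C n, ?_⟩⟩
    have hW : ((2 * C + 4 : ℕ) : ℝ) ≤ (d : ℝ) ^ 2 := by exact_mod_cast (by omega)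
    have hι : 5 ≤ d → d ^ ((k - 1) * (d - 1)) ≤ Fintype.card (Fin (k - 1) → Fin C → Bool) := by
      intro h
      simpa using pow_le_two_pow_of_five_le k h
    obtain ⟨hdet, hnon, hpq⟩ := cellFunction_mem_classes k C n hW
    obtain ⟨s, hs, a, ha⟩ := cellFunction_rowsSeparated_natural (k := k) (C := C) hn
    exact ⟨hdet, hnon, hpq,
      notMem_classOBDD hk (by omega) hι (exists_cut_cellFunction_rowsSeparated (by omega)),
      notMem_classIdNOBDD hk hd hι hs ha, fun ε hε hε2 hD =>
        ⟨notMem_classIdPOBDD hk hε hε2 hD hι hs ha, notMem_classIdQOBDD hk hε hε2 hD hι hs ha⟩⟩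
  · subst hdt
    have hd : 2 ≤ 2 ^ t := Nat.le_self_pow (by omega) 2
    obtain ⟨hdet, hnon, hpq⟩ := mxpj_mem_classes hn le_rfl
    have ha := mxpj_rowsSeparated ht hn
    have hι : 5 ≤ 2 ^ t → (2 ^ t) ^ ((k - 1) * (2 ^ t - 1)) ≤
        Fintype.card (Fin (k - 1) → Fin (2 ^ t - 1) → Fin (2 ^ t)) := by
      intro _
      simp only [Fintype.card_fun, Fintype.card_fin]
      rw [← pow_mul _ (2 ^ t - 1), mul_comm (k - 1)]
    have hs : k * 2 ^ t * t < n := by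
      have : 0 < k * 2 ^ t * t := by positivity
      have e : 2 * k * 2 ^ t * t = 2 * (k * 2 ^ t * t) := by ring
      omega
    exact ⟨hdet, hnon, hpq, notMem_classIdOBDD hk hι hs ha, notMem_classIdNOBDD hk hd hι hs ha,
      fun ε hε hε2 hD =>
        ⟨notMem_classIdPOBDD hk hε hε2 hD hι hs ha, notMem_classIdQOBDD hk hε hε2 hD hι hs ha⟩⟩
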